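/- **Theorem 1.** Let $T>0$, $X_0\in\mathbb{R}^d$, and let $\mu:\mathbb{R}^d\to\mathbb{R}^d$, $\sigma_1,\dots,\sigma_m:\mathbb{R}^d\to\mathbb{R}^d$ (the columns of $\sigma$) and $f:\mathbb{R}^d\to\mathbb{R}$ be $C^2$ and globally Lipschitz with bounded second derivatives. Let $\Omega\in\mathbb{R}^{m\times m}$ and $\Delta_l=2^{-l}T$. For a step size $h$ and increments $z_1,z_2,\dots\in\mathbb{R}^m$, the Milstein scheme without Lévy areas is $X_0$ as given and $$X_{i}=X_{i-1}+\mu(X_{i-1})h+\sum_{j=1}^m\sigma_j(X_{i-1})z_{i,j}+\frac12\sum_{j,k=1}^m\sigma_j'(X_{i-1})\sigma_k(X_{i-1})\,(z_{i,j}z_{i,k}-\Omega_{jk}h).$$ Let $1\le l\le L$. The fine increments $\xi^f_{l,i}$, $i=1,\dots,2^l$, are independent $\mathbb{R}^m$-valued random vectors, each of whose components is distributed as $$\bigl(\mathrm{Bin}(2^{L-l},\tfrac12)-2^{L-l-1}\bigr)\cdot 2\sqrt{\Delta_L},$$ (for $l=L$: $\pm\sqrt{\Delta_L}$ with probability $\frac12$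 each), and $\mathbb{E}[\xi^f_{l,i,j}\xi^f_{l,i,k}]=\Omega_{jk}\Delta_l$; in particular $\Omega$ is the identity matrix when the components are independent. The coarse increments are $\xi^c_{l-1,i}=\xi^f_{l,2i-1}+\xi^f_{l,2i}$, $i=1,\dots,2^{l-1}$. Let $X^f$ be the scheme with step $\Delta_l$ and increments $\xi^f_{l,i}$; let $X^a$ (the antithetic path) be the same scheme with $\xi^f_{l,2i-1}$ and $\xi^f_{l,2i}$ swapped for every $i$; let $X^c$ be the scheme with step $\Delta_{l-1}$ and increments $\xi^c_{l-1,i}$; all are taken at the final time $T$. Put $$\hat P^f_l=\tfrac12\bigl(f(X^f)+f(X^a)\bigr),\qquad \hat P^c_{l-1}=f(X^c),\qquad \hat Y_l=\frac1{M}\sum_{r=1}^{M}\bigl(\hat P^{f,r}_l-\hat P^{c,r}_{l-1}\bigr),$$ the sum being over $M\ge1$ independent realizations $r$ of the fine increments. Then there is a constant $C$, depending only on $\mu,\sigma,\Omega,X_0,T,f$ and not on $L$, $l$, $M$, such that $\hat Y_l$ is square integrable and $$\operatorname{Var}(\hat Y_l)\le \frac{C\,\Delta_l^2}{M}\qquad\text{for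 all }1\le l\le L,\ M\ge1;$$ in particular ($M=1$) the level-difference variance is $O(\Delta_l^2)$, i.e. $\beta=2$. -/

import Mathlib

open MeasureTheory ProbabilityTheory

noncomputable section

namespace WeakMilstein

/-- The step size `Δ_l = 2^{-l} T` on level `l`. -/
def stepSize (T : ℝ) (l : ℕ) : ℝ := T / 2 ^ l

/-- `C²`, globally Lipschitz, and with uniformly bounded second derivative. -/
def IsLipschitzC2 {E F : Type*} [NormedAddCommGroup E] [NormedSpace ℝ E]
    [NormedAddCommGroup F] [NormedSpace ℝ F] (g : E → F) : Prop :=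
  ContDiff ℝ 2 g ∧ (∃ K, LipschitzWith K g) ∧ ∃ K : ℝ, ∀ x, ‖fderiv ℝ (fderiv ℝ g) x‖ ≤ K

/-- The law of `(Bin(2^(L-l), 1/2) - 2^(L-l-1)) * 2 * √Δ_L` (used for `l ≤ L`). For `l = L` it is
the two-point law giving probability `1/2` to each of `√Δ_L` and `-√Δ_L`. -/
def weakIncrementLaw (T : ℝ) (L l : ℕ) : Measure ℝ :=
  (binomial (2 ^ (L - l)) ⟨1 / 2, by norm_num, by norm_num⟩).map
    (fun k : ℕ => ((k : ℝ) - 2 ^ (L - l) / 2) * (2 * √(stepSize T L)))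

section Scheme

variable {d m : ℕ}

/-- One step, of size `h` and with increment `z`, of the Milstein scheme without Lévy areas, for the
drift `μ`, the diffusion coefficient with columns `σ j` and the noise correlation matrix `Ω`. -/
def milsteinStep (μ : EuclideanSpace ℝ (Fin d) → EuclideanSpace ℝ (Fin d))
    (σ : Fin m → EuclideanSpace ℝ (Fin d) → EuclideanSpace ℝ (Fin d))
    (Ω : Matrix (Fin m) (Fin m) ℝ) (h : ℝ) (x : EuclideanSpace ℝ (Fin d)) (z : Fin m → ℝ) :
    EuclideanSpace ℝ (Fin d) :=
  x + h • μ x + ∑ j, z j • σ j x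
    + (1 / 2 : ℝ) • ∑ j, ∑ k, (z j * z k - Ω j k * h) • fderiv ℝ (σ j) x (σ k x)

/-- The Milstein path without Lévy areas, started in `x₀`; `z i` is the increment used in the
step from time `i h` to time `(i + 1) h`. -/
def milsteinPath (μ : EuclideanSpace ℝ (Fin d) → EuclideanSpace ℝ (Fin d))
    (σ : Fin m → EuclideanSpace ℝ (Fin d) → EuclideanSpace ℝ (Fin d))
    (Ω : Matrix (Fin m) (Fin m) ℝ) (x₀ : EuclideanSpace ℝ (Fin d)) (h : ℝ) (z : ℕ → Fin m → ℝ) :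
    ℕ → EuclideanSpace ℝ (Fin d)
  | 0 => x₀
  | i + 1 => milsteinStep μ σ Ω h (milsteinPath μ σ Ω x₀ h z i) (z i)

/-- The coarse increments coupled to the fine increments `z` with zero remainder: each is the sum of
the two fine increments over the same coarse time step. -/
def coarseIncrement (z : ℕ → Fin m → ℝ) : ℕ → Fin m → ℝ := fun i => z (2 * i) + z (2 * i + 1)

/-- The fine increments with the two increments in each coarse time step swapped. -/
def antitheticIncrement (z : ℕ → Fin m → ℝ) : ℕ → Fin m → ℝ :=
  fun i => if Even i then z (i + 1) else z (i - 1)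

/-- The fine antithetic payoff `(f(X^f) + f(X^a)) / 2` on level `l`, at the final time `T`. -/
def finePayoff (μ : EuclideanSpace ℝ (Fin d) → EuclideanSpace ℝ (Fin d))
    (σ : Fin m → EuclideanSpace ℝ (Fin d) → EuclideanSpace ℝ (Fin d))
    (Ω : Matrix (Fin m) (Fin m) ℝ) (x₀ : EuclideanSpace ℝ (Fin d))
    (f : EuclideanSpace ℝ (Fin d) → ℝ) (T : ℝ) (l : ℕ) (z : ℕ → Fin m → ℝ) : ℝ :=
  (1 / 2) * (f (milsteinPath μ σ Ω x₀ (stepSize T l) z (2 ^ l))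
    + f (milsteinPath μ σ Ω x₀ (stepSize T l) (antitheticIncrement z) (2 ^ l)))

/-- The payoff `f(X^c)` of the coarse path on level `l`, at the final time `T`. -/
def coarsePayoff (μ : EuclideanSpace ℝ (Fin d) → EuclideanSpace ℝ (Fin d))
    (σ : Fin m → EuclideanSpace ℝ (Fin d) → EuclideanSpace ℝ (Fin d))
    (Ω : Matrix (Fin m) (Fin m) ℝ) (x₀ : EuclideanSpace ℝ (Fin d))
    (f : EuclideanSpace ℝ (Fin d) → ℝ) (T : ℝ) (l : ℕ) (z : ℕ → Fin m → ℝ) : ℝ :=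
  f (milsteinPath μ σ Ω x₀ (stepSize T l) z (2 ^ l))

/-- The antithetic multilevel estimator for level `l ≥ 1` with `M` realizations `z 0, …, z (M - 1)`
of the fine increments of level `l`: the average of the differences of the fine payoff on level `l`
and the coarse payoff on level `l - 1`. -/
def levelEstimator (μ : EuclideanSpace ℝ (Fin d) → EuclideanSpace ℝ (Fin d))
    (σ : Fin m → EuclideanSpace ℝ (Fin d) → EuclideanSpace ℝ (Fin d))
    (Ω : Matrix (Fin m) (Fin m) ℝ) (x₀ : EuclideanSpace ℝ (Fin d))
    (f : EuclideanSpace ℝ (Fin d) → ℝ) (T : ℝ) (l M : ℕ) (z : Fin M → ℕ → Fin m → ℝ) : ℝ :=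
  (M : ℝ)⁻¹ * ∑ r, (finePayoff μ σ Ω x₀ f T l (z r)
    - coarsePayoff μ σ Ω x₀ f T (l - 1) (coarseIncrement (z r)))

/-- `ξ r i`, for `r < M` and `i < 2^l`, are independent random vectors, the weak Wiener increments
of level `l` (for the finest level `L`) in `M` independent realizations: their components follow the
binomial law `weakIncrementLaw T L l`, and the components of one increment have correlation matrix
`Ω` (so that `Ω = 1` if the components are independent). -/
structure IsWeakIncrements {S : Type*} [MeasurableSpace S] (P : Measure S) (T : ℝ)
    (Ω : Matrix (Fin m) (Fin m) ℝ) (L l M : ℕ) (ξ : Fin M → ℕ → S → Fin m → ℝ) : Prop where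
  indep : iIndepFun (fun (p : Fin M × Fin (2 ^ l)) => ξ p.1 p.2) P
  law : ∀ r, ∀ i < 2 ^ l, ∀ j, HasLaw (fun s => ξ r i s j) (weakIncrementLaw T L l) P
  corr : ∀ r, ∀ i < 2 ^ l, ∀ j k, ∫ s, ξ r i s j * ξ r i s k ∂P = Ω j k * stepSize T l

end Scheme

end WeakMilstein

end

noncomputable section

namespace WeakMilstein

/-! Write δ = √Δ_l and group the fine steps in pairs, one pair per coarse step. Let x, x', y be the
fine, antithetic and coarse states. Separately, x − y and x' − y are only of order δ: two fine steps
produce the quadratic noise `pairIncr`, which depends on the order of the two increments (the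
missing Lévy area), while the coarse step sees its symmetrization. Averaging over the two orders
cancels the antisymmetric part to leading order, so the midpoint error e = (x + x')/2 − y has order
δ². A Taylor expansion of f at y bounds the payoff difference by a multiple of ‖e‖ + ‖x − y‖² + ‖x'
− y‖², so its second moment is O(δ⁴) = O(Δ_l²).

All these orders are propagated by one induction. The function `lyapunov` adds ‖e‖², the fourth
powers of x − y and x' − y, and δ⁴ times fourth powers of the states. In each piece the change over
one coarse step is M + B, with M centred of size δα and B of size δ²α, where a power of α is
controlled by `lyapunov` itself. The terms linear in M vanish in mean, so the mean of `lyapunov`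
grows at most by a factor 1 + Kδ² (`integral_norm_add_sq_le`, `integral_norm_add_pow_four_le`,
`IsStepNoise.integral_lyapunov_le`). It starts at δ⁴(3 + 3‖x₀‖⁴), and 2^(l-1) coarse steps cost at
most exp(KT) (`lintegral_lyapunov_le`).

The constants do not depend on L or l because the increments divided by δ are subgaussian uniformly
in both (`integral_exp_normalized_le`). Pathwise estimates collect all constants and normalized
increments in a random scale ρ; only the powers of δ and of the state matter, and the power of ρ may
be wasteful because high moments of ρ are bounded. -/

/-- Quantitative form of `IsLipschitzC2` with a single constant. -/
structure C2Bounds {E F : Type*} [NormedAddCommGroup E] [NormedSpace ℝ E]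
    [NormedAddCommGroup F] [NormedSpace ℝ F] (κ : ℝ) (g : E → F) : Prop where
  growth : ∀ x, ‖g x‖ ≤ κ * (1 + ‖x‖)
  lip : ∀ x y, ‖g x - g y‖ ≤ κ * ‖x - y‖
  fderiv_le : ∀ x, ‖fderiv ℝ g x‖ ≤ κ
  fderiv_lip : ∀ x y, ‖fderiv ℝ g x - fderiv ℝ g y‖ ≤ κ * ‖x - y‖
  taylor : ∀ x y, ‖g y - g x - fderiv ℝ g x (y - x)‖ ≤ κ * ‖y - x‖ ^ 2

/-! ### Uniform constants for `C²` Lipschitz functions. -/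

section C2

variable {E F : Type*} [NormedAddCommGroup E] [NormedSpace ℝ E]
    [NormedAddCommGroup F] [NormedSpace ℝ F]

lemma C2Bounds.mono {κ κ' : ℝ} {g : E → F} (hg : C2Bounds κ g) (h : κ ≤ κ') :
    C2Bounds κ' g where
  growth x := (hg.growth x).trans (by gcongr)
  lip x y := (hg.lip x y).trans (by gcongr)
  fderiv_le x := (hg.fderiv_le x).trans h
  fderiv_lip x y := (hg.fderiv_lip x y).trans (by gcongr)
  taylor x y := (hg.taylor x y).trans (by gcongr)

lemma IsLipschitzC2.exists_bounds {g : E → F} (hg : IsLipschitzC2 g) :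
    ∃ κ, 0 ≤ κ ∧ C2Bounds κ g := by
  obtain ⟨hC, ⟨K₁, h₁⟩, K₂, h₂⟩ := hg
  have hd : Differentiable ℝ g := hC.differentiable (by norm_num)
  have hd' : Differentiable ℝ (fderiv ℝ g) :=
    (hC.fderiv_right (m := 1) (by norm_num)).differentiable (by norm_num)
  have hK₂ : 0 ≤ K₂ := (norm_nonneg (fderiv ℝ (fderiv ℝ g) 0)).trans (h₂ 0)
  have hlip : ∀ x y, ‖fderiv ℝ g x - fderiv ℝ g y‖ ≤ K₂ * ‖x - y‖ := fun x y =>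
    Convex.norm_image_sub_le_of_norm_fderiv_le (fun z _ => hd' z) (fun z _ => h₂ z)
      convex_univ (Set.mem_univ y) (Set.mem_univ x)
  have htay : ∀ x y, ‖g y - g x - fderiv ℝ g x (y - x)‖ ≤ K₂ * ‖y - x‖ ^ 2 := by
    intro x y
    -- On the ball of radius ‖y - x‖ the derivative differs from its value at `x` by at most `K₂ *
    -- ‖y - x‖`; the mean value inequality then gives the Taylor bound, without the optimal factor
    -- 1/2.
    have := Convex.norm_image_sub_le_of_norm_fderiv_le' (𝕜 := ℝ) (f := g)
      (s := Metric.closedBall x ‖y - x‖) (φ := fderiv ℝ g x) (C := K₂ * ‖y - x‖) (x := x) (y := y)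
      (fun z _ => hd z)
      (fun z hz => (hlip z x).trans (by
        rw [mem_closedBall_iff_norm] at hz; gcongr))
      (convex_closedBall _ _) (by simp) (by simp [dist_eq_norm])
    calc _ ≤ _ := this
      _ = _ := by ring
  have hK : 0 ≤ max (K₁ : ℝ) (max K₂ ‖g 0‖) := le_max_of_le_left K₁.2
  have e₁ : (K₁ : ℝ) ≤ max (K₁ : ℝ) (max K₂ ‖g 0‖) := le_max_left _ _
  have e₂ : K₂ ≤ max (K₁ : ℝ) (max K₂ ‖g 0‖) := (le_max_left _ _).trans (le_max_right _ _)
  have e₃ : ‖g 0‖ ≤ max (K₁ : ℝ) (max K₂ ‖g 0‖) := (le_max_right _ _).trans (le_max_right _ _)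
  have hl : ∀ x y, ‖g x - g y‖ ≤ max (K₁ : ℝ) (max K₂ ‖g 0‖) * ‖x - y‖ := fun x y => by
    have := h₁.dist_le_mul x y
    rw [dist_eq_norm, dist_eq_norm] at this
    exact this.trans (by gcongr)
  refine ⟨_, hK, ?_, hl, fun x => ?_, fun x y => (hlip x y).trans (by gcongr),
    fun x y => (htay x y).trans (by gcongr)⟩
  · intro x
    have h := hl x 0
    rw [sub_zero] at h
    calc ‖g x‖ = ‖(g x - g 0) + g 0‖ := by rw [sub_add_cancel]
      _ ≤ ‖g x - g 0‖ + ‖g 0‖ := norm_add_le _ _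
      _ ≤ _ := by linarith
  · exact (norm_fderiv_le_of_lipschitz ℝ h₁).trans e₁

end C2

/-! ### Calculus of bounds up to powers of the scale. -/

/-- `v` is bounded by `a` up to a factor `ρ ^ n`. -/
def Bd {E : Type*} [Norm E] (ρ : ℝ) (n : ℕ) (a : ℝ) (v : E) : Prop := ‖v‖ ≤ ρ ^ n * a

namespace Bd

variable {E : Type*} [NormedAddCommGroup E] {ρ : ℝ} {n n' : ℕ} {a b c : ℝ}
  {u v : E}

lemma mono_exp (hρ : 4 ≤ ρ) (h : Bd ρ n a v) (hn : n ≤ n') : Bd ρ n' a v := by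
  unfold Bd at *
  have ha : 0 ≤ a := by
    by_contra! ha
    have : ρ ^ n * a < 0 := mul_neg_of_pos_of_neg (by positivity) ha
    linarith [norm_nonneg v]
  exact h.trans (by gcongr; linarith)

lemma mono (hρ : 4 ≤ ρ) (h : Bd ρ n a v) (hab : a ≤ b) : Bd ρ n b v :=
  le_trans h (by gcongr)

/-- Absorb a factor `ρ ^ k` of the bound into the exponent. -/
lemma absorb (hρ : 4 ≤ ρ) (h : Bd ρ n a v) (k : ℕ) (hab : a ≤ ρ ^ k * b) : Bd ρ (n + k) b v := by
  refine le_trans h ?_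
  rw [pow_add, mul_assoc]
  gcongr

lemma add (hρ : 4 ≤ ρ) (hu : Bd ρ n a u) (hv : Bd ρ n a v) : Bd ρ (n + 1) a (u + v) := by
  have h0 : 0 ≤ ρ ^ n * a := (norm_nonneg u).trans hu
  calc ‖u + v‖ ≤ ‖u‖ + ‖v‖ := norm_add_le _ _
    _ ≤ ρ ^ n * a + ρ ^ n * a := add_le_add hu hv
    _ ≤ ρ * (ρ ^ n * a) := by nlinarith
    _ = _ := by ring

lemma neg (hu : Bd ρ n a u) : Bd ρ n a (-u) := by simpa [Bd] using hu

lemma sub (hρ : 4 ≤ ρ) (hu : Bd ρ n a u) (hv : Bd ρ n a v) : Bd ρ (n + 1) a (u - v) := by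
  rw [sub_eq_add_neg]; exact hu.add hρ hv.neg

variable [NormedSpace ℝ E]

lemma smul (hv : Bd ρ n a v) {t : ℝ} (ht : |t| ≤ c) : Bd ρ n (c * a) (t • v) := by
  have h0 : 0 ≤ ρ ^ n * a := (norm_nonneg v).trans hv
  calc ‖t • v‖ = |t| * ‖v‖ := by rw [norm_smul, Real.norm_eq_abs]
    _ ≤ c * (ρ ^ n * a) := by
      have := (abs_nonneg t).trans ht
      unfold Bd at hv
      gcongr
    _ = _ := by ring

lemma smul_of_le_one (hv : Bd ρ n a v) {t : ℝ} (ht : |t| ≤ 1) : Bd ρ n a (t • v) := by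
  refine le_trans ?_ hv
  rw [norm_smul, Real.norm_eq_abs]
  exact mul_le_of_le_one_left (norm_nonneg _) ht

lemma clm {F : Type*} [NormedAddCommGroup F] [NormedSpace ℝ F] {κ : ℝ} (hρ : 4 ≤ ρ)
    {A : E →L[ℝ] F} (hA : ‖A‖ ≤ κ) (hκ : κ ≤ ρ) (hv : Bd ρ n a v) : Bd ρ (n + 1) a (A v) := by
  have h0 : 0 ≤ ρ ^ n * a := (norm_nonneg v).trans hv
  calc ‖A v‖ ≤ ‖A‖ * ‖v‖ := A.le_opNorm v
    _ ≤ ρ * (ρ ^ n * a) := by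
      unfold Bd at hv
      gcongr
      exact hA.trans hκ
    _ = _ := by ring

end Bd

/-! ### Linear and quadratic expressions in the increments. -/

section Sums

variable {E : Type*} [NormedAddCommGroup E] [NormedSpace ℝ E] {m : ℕ}

/-- The linear combination `∑ j, z j • v j`. -/
def lin (v : Fin m → E) (z : Fin m → ℝ) : E := ∑ j, z j • v j

/-- The linear combination `∑ j k, q j k • v j k`. -/
def quad (v : Fin m → Fin m → E) (q : Fin m → Fin m → ℝ) : E := ∑ j, ∑ k, q j k • v j k

lemma lin_sub_left (u v : Fin m → E) (z : Fin m → ℝ) :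
    lin (fun j => u j - v j) z = lin u z - lin v z := by
  simp [lin, smul_sub]

lemma lin_add_right (v : Fin m → E) (z w : Fin m → ℝ) :
    lin v (z + w) = lin v z + lin v w := by
  simp [lin, add_smul, Finset.sum_add_distrib]

lemma quad_sub_left (u v : Fin m → Fin m → E) (q : Fin m → Fin m → ℝ) :
    quad (fun j k => u j k - v j k) q = quad u q - quad v q := by
  simp [quad, smul_sub]

lemma quad_add_right (v : Fin m → Fin m → E) (p q : Fin m → Fin m → ℝ) :
    quad v (p + q) = quad v p + quad v q := by
  simp [quad, add_smul, Finset.sum_add_distrib]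

lemma quad_smul_right (v : Fin m → Fin m → E) (c : ℝ) (q : Fin m → Fin m → ℝ) :
    quad v (c • q) = c • quad v q := by
  simp [quad, mul_smul, Finset.smul_sum]

lemma lin_lin (v : Fin m → Fin m → E) (z w : Fin m → ℝ) :
    lin (fun j => lin (v j) z) w = quad v (fun j k => w j * z k) := by
  simp [lin, quad, Finset.smul_sum, mul_smul]

lemma map_lin {F : Type*} [NormedAddCommGroup F] [NormedSpace ℝ F] (A : E →L[ℝ] F)
    (v : Fin m → E) (z : Fin m → ℝ) : A (lin v z) = lin (fun j => A (v j)) z := by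
  simp [lin]

lemma norm_lin_le {v : Fin m → E} {z : Fin m → ℝ} {V c : ℝ} (hv : ∀ j, ‖v j‖ ≤ V) (hV : 0 ≤ V)
    (hz : ∑ j, |z j| ≤ c) : ‖lin v z‖ ≤ c * V := by
  calc ‖lin v z‖ ≤ ∑ j, ‖z j • v j‖ := norm_sum_le _ _
    _ ≤ ∑ j, |z j| * V := Finset.sum_le_sum fun j _ => by
      rw [norm_smul, Real.norm_eq_abs]; gcongr; exact hv j
    _ = (∑ j, |z j|) * V := by rw [Finset.sum_mul]
    _ ≤ c * V := by gcongr

lemma norm_quad_le {v : Fin m → Fin m → E} {q : Fin m → Fin m → ℝ} {V c : ℝ}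
    (hv : ∀ j k, ‖v j k‖ ≤ V) (hV : 0 ≤ V) (hq : ∑ j, ∑ k, |q j k| ≤ c) :
    ‖quad v q‖ ≤ c * V := by
  calc ‖quad v q‖ ≤ ∑ j, ‖∑ k, q j k • v j k‖ := norm_sum_le _ _
    _ ≤ ∑ j, ∑ k, |q j k| * V := Finset.sum_le_sum fun j _ => by
      have := norm_lin_le (hv j) hV (le_refl (∑ k, |q j k|))
      rw [lin, Finset.sum_mul] at this
      exact this
    _ = (∑ j, ∑ k, |q j k|) * V := by simp_rw [Finset.sum_mul]
    _ ≤ c * V := by gcongr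

lemma Bd.lin {ρ δ a : ℝ} {n : ℕ} {v : Fin m → E} {z : Fin m → ℝ} (hρ : 4 ≤ ρ) (ha : 0 ≤ a)
    (hv : ∀ j, Bd ρ n a (v j)) (hz : ∑ j, |z j| ≤ δ * ρ) :
    Bd ρ (n + 1) (δ * a) (lin v z) := by
  refine (norm_lin_le hv (by positivity) hz).trans (le_of_eq ?_)
  ring

lemma Bd.quad {ρ c a : ℝ} {n k : ℕ} {v : Fin m → Fin m → E} {q : Fin m → Fin m → ℝ}
    (hρ : 4 ≤ ρ) (ha : 0 ≤ a)
    (hv : ∀ i j, Bd ρ n a (v i j)) (hq : ∑ i, ∑ j, |q i j| ≤ c * ρ ^ k) :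
    Bd ρ (n + k) (c * a) (quad v q) := by
  refine (norm_quad_le hv (by positivity) hq).trans (le_of_eq ?_)
  ring

end Sums

/-! ### Weakly centred random vectors. -/

section MeanZero

variable {W : Type*} [MeasurableSpace W] {ν : Measure W}
  {E : Type*} [NormedAddCommGroup E] [NormedSpace ℝ E]

/-- `M` is weakly centred: every continuous linear functional of it has mean zero. -/
def MeanZero (ν : Measure W) (M : W → E) : Prop := ∀ φ : E →L[ℝ] ℝ, ∫ ω, φ (M ω) ∂ν = 0

variable (hint : ∀ g : W → ℝ, Integrable g ν) {M N : W → E}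

include hint in
lemma MeanZero.add (hM : MeanZero ν M) (hN : MeanZero ν N) : MeanZero ν (fun ω => M ω + N ω) := by
  intro φ
  simp only [map_add]
  rw [integral_add (hint _) (hint _), hM, hN, add_zero]

lemma MeanZero.clm {F : Type*} [NormedAddCommGroup F] [NormedSpace ℝ F] (A : E →L[ℝ] F)
    (hM : MeanZero ν M) : MeanZero ν (fun ω => A (M ω)) := fun φ => hM (φ.comp A)

lemma MeanZero.smul (c : ℝ) (hM : MeanZero ν M) : MeanZero ν (fun ω => c • M ω) := by
  intro φ
  simp only [map_smul, smul_eq_mul]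
  rw [integral_const_mul, hM, mul_zero]

include hint in
lemma MeanZero.sub (hM : MeanZero ν M) (hN : MeanZero ν N) : MeanZero ν (fun ω => M ω - N ω) := by
  simpa [sub_eq_add_neg] using hM.add hint (hN.smul (-1))

include hint in
lemma MeanZero.sum {ι : Type*} (s : Finset ι) {M : ι → W → E} (hM : ∀ i ∈ s, MeanZero ν (M i)) :
    MeanZero ν (fun ω => ∑ i ∈ s, M i ω) := by
  intro φ
  simp only [map_sum]
  rw [integral_finsetSum _ (fun i _ => hint _)]
  exact Finset.sum_eq_zero fun i hi => hM i hi φ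

end MeanZero

/-! ### Second and fourth moments after a nearly centred perturbation. -/

section Moments

variable {W : Type*} [MeasurableSpace W] {ν : Measure W} [IsProbabilityMeasure ν]
  {E : Type*} [NormedAddCommGroup E] [InnerProductSpace ℝ E]

/-- Square the expansion of ‖e + b‖². The term linear in `b` is kept exactly, since its centred part
will integrate to zero; Cauchy-Schwarz and 2‖e‖‖b‖³ ≤ ‖e‖²‖b‖² + ‖b‖⁴ absorb the others. -/
lemma norm_add_pow_four_le (e b : E) :
    ‖e + b‖ ^ 4 ≤ ‖e‖ ^ 4 + 4 * ‖e‖ ^ 2 * inner ℝ e b + 8 * ‖e‖ ^ 2 * ‖b‖ ^ 2 + 3 * ‖b‖ ^ 4 := by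
  have h : ‖e + b‖ ^ 2 = ‖e‖ ^ 2 + 2 * inner ℝ e b + ‖b‖ ^ 2 := norm_add_sq_real e b
  have hi : |inner ℝ e b| ≤ ‖e‖ * ‖b‖ := abs_real_inner_le_norm e b
  have hs : inner ℝ e b ^ 2 ≤ ‖e‖ ^ 2 * ‖b‖ ^ 2 := by
    rw [← mul_pow, ← sq_abs]; gcongr
  have h3 : inner ℝ e b * ‖b‖ ^ 2 ≤ ‖e‖ * ‖b‖ * ‖b‖ ^ 2 := by
    gcongr; exact (le_abs_self _).trans hi
  have h4 : (‖e + b‖ ^ 2) ^ 2 = ‖e + b‖ ^ 4 := by ring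
  rw [← h4, h]
  nlinarith [sq_nonneg (‖e‖ * ‖b‖ - ‖b‖ ^ 2)]

lemma norm_centred_add_le {W E : Type*} [NormedAddCommGroup E] {M B : W → E} {ρ : W → ℝ}
    {δ α : ℝ} {k : ℕ} (hρ : ∀ ω, 4 ≤ ρ ω) (hδρ : ∀ ω, δ ≤ ρ ω)
    (hδ : 0 < δ) (hα : 0 ≤ α)
    (hM : ∀ ω, Bd (ρ ω) k (δ * α) (M ω)) (hB : ∀ ω, Bd (ρ ω) k (δ ^ 2 * α) (B ω)) (ω : W) :
    ‖M ω + B ω‖ ≤ ρ ω ^ (k + 2) * (δ * α) := by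
  refine Bd.add (n := k + 1) (hρ ω) ((hM ω).mono_exp (hρ ω) (by omega))
    ((hB ω).absorb (hρ ω) 1 ?_)
  have := hδρ ω
  calc δ ^ 2 * α = δ * (δ * α) := by ring
    _ ≤ ρ ω ^ 1 * (δ * α) := by rw [pow_one]; gcongr

variable {M B : W → E} {ρ : W → ℝ} {δ α C : ℝ} {k : ℕ}

/-- The only contribution of order δ is 2⟨e, M⟩, which has mean zero. What remains is ⟨e, B⟩ and the
square of the perturbation, both of order δ². -/
lemma integral_norm_add_sq_le (hint : ∀ g : W → ℝ, Integrable g ν)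
    (hρ : ∀ ω, 4 ≤ ρ ω) (hδρ : ∀ ω, δ ≤ ρ ω) (hδ : 0 < δ) (hα : 0 ≤ α)
    (hC : ∫ ω, ρ ω ^ (2 * k + 4) ∂ν ≤ C) (h0 : MeanZero ν M)
    (hM : ∀ ω, Bd (ρ ω) k (δ * α) (M ω)) (hB : ∀ ω, Bd (ρ ω) k (δ ^ 2 * α) (B ω)) (e : E) :
    ∫ ω, ‖e + (M ω + B ω)‖ ^ 2 ∂ν ≤ ‖e‖ ^ 2 + C * (2 * δ ^ 2 * (‖e‖ ^ 2 + α ^ 2)) := by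
  have key : ∀ ω, ‖e + (M ω + B ω)‖ ^ 2 ≤ ‖e‖ ^ 2 + 2 * inner ℝ e (M ω) +
      ρ ω ^ (2 * k + 4) * (2 * δ ^ 2 * (‖e‖ ^ 2 + α ^ 2)) := by
    intro ω
    have h1 := norm_centred_add_le hρ hδρ hδ hα hM hB ω
    have hρ0 : 1 ≤ ρ ω := by linarith [hρ ω]
    have h2 : ‖M ω + B ω‖ ^ 2 ≤ ρ ω ^ (2 * k + 4) * (δ ^ 2 * α ^ 2) := by
      calc ‖M ω + B ω‖ ^ 2 ≤ (ρ ω ^ (k + 2) * (δ * α)) ^ 2 := by gcongr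
        _ = _ := by ring
    have h3 : inner ℝ e (B ω) ≤ ρ ω ^ (2 * k + 4) * (δ ^ 2 * (‖e‖ * α)) := by
      calc inner ℝ e (B ω) ≤ ‖e‖ * ‖B ω‖ := real_inner_le_norm _ _
        _ ≤ ‖e‖ * (ρ ω ^ (2 * k + 4) * (δ ^ 2 * α)) := by
          gcongr
          exact (hB ω).mono_exp (hρ ω) (by omega)
        _ = _ := by ring
    rw [norm_add_sq_real, inner_add_right]
    have h4 : ρ ω ^ (2 * k + 4) * (δ ^ 2 * (‖e‖ * α)) * 2 ≤
        ρ ω ^ (2 * k + 4) * (δ ^ 2 * (‖e‖ ^ 2 + α ^ 2)) := by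
      rw [mul_assoc, mul_assoc]
      gcongr
      nlinarith [sq_nonneg (‖e‖ - α)]
    have h5 : 0 ≤ ρ ω ^ (2 * k + 4) * (δ ^ 2 * ‖e‖ ^ 2) := by positivity
    linarith
  calc ∫ ω, ‖e + (M ω + B ω)‖ ^ 2 ∂ν ≤ ∫ ω, (‖e‖ ^ 2 + 2 * inner ℝ e (M ω) +
      ρ ω ^ (2 * k + 4) * (2 * δ ^ 2 * (‖e‖ ^ 2 + α ^ 2))) ∂ν :=
        integral_mono (hint _) (hint _) key
    _ = ‖e‖ ^ 2 + (∫ ω, ρ ω ^ (2 * k + 4) ∂ν) * (2 * δ ^ 2 * (‖e‖ ^ 2 + α ^ 2)) := by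
      have := h0 (innerSL ℝ e)
      simp only [innerSL_apply_apply] at this
      rw [integral_add (hint _) (hint _), integral_add (hint _) (hint _), integral_const_mul,
        integral_mul_const, this]
      simp
    _ ≤ _ := by gcongr

lemma integral_norm_add_pow_four_le (hint : ∀ g : W → ℝ, Integrable g ν)
    (hρ : ∀ ω, 4 ≤ ρ ω) (hδρ : ∀ ω, δ ≤ ρ ω) (hδ : 0 < δ) (hα : 0 ≤ α)
    (hC : ∫ ω, ρ ω ^ (4 * k + 10) ∂ν ≤ C) (h0 : MeanZero ν M)
    (hM : ∀ ω, Bd (ρ ω) k (δ * α) (M ω)) (hB : ∀ ω, Bd (ρ ω) k (δ ^ 2 * α) (B ω)) (e : E) :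
    ∫ ω, ‖e + (M ω + B ω)‖ ^ 4 ∂ν ≤ ‖e‖ ^ 4 + C * (15 * δ ^ 2 * (‖e‖ ^ 4 + α ^ 4)) := by
  have key : ∀ ω, ‖e + (M ω + B ω)‖ ^ 4 ≤ ‖e‖ ^ 4 + 4 * ‖e‖ ^ 2 * inner ℝ e (M ω) +
      ρ ω ^ (4 * k + 10) * (15 * δ ^ 2 * (‖e‖ ^ 4 + α ^ 4)) := by
    intro ω
    have h1 := norm_centred_add_le hρ hδρ hδ hα hM hB ω
    have hρ0 : 1 ≤ ρ ω := by linarith [hρ ω]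
    have h2 : ‖M ω + B ω‖ ^ 2 ≤ ρ ω ^ (4 * k + 10) * (δ ^ 2 * α ^ 2) := by
      calc ‖M ω + B ω‖ ^ 2 ≤ (ρ ω ^ (k + 2) * (δ * α)) ^ 2 := by gcongr
        _ = ρ ω ^ (2 * k + 4) * (δ ^ 2 * α ^ 2) := by ring
        _ ≤ _ := by gcongr <;> first | exact hρ0 | omega
    -- The fourth power carries δ⁴ where δ² is wanted. As δ need not be below 1, the spare δ² is
    -- traded for ρ², whence the exponent 4k + 10.
    have h2' : ‖M ω + B ω‖ ^ 4 ≤ ρ ω ^ (4 * k + 10) * (δ ^ 2 * α ^ 4) := by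
      calc ‖M ω + B ω‖ ^ 4 ≤ (ρ ω ^ (k + 2) * (δ * α)) ^ 4 := by gcongr
        _ = ρ ω ^ (4 * k + 8) * (δ ^ 2 * (δ ^ 2 * α ^ 4)) := by ring
        _ ≤ ρ ω ^ (4 * k + 8) * (δ ^ 2 * (ρ ω ^ 2 * α ^ 4)) := by
          have := hδρ ω
          gcongr
        _ = _ := by ring
    have h3 : inner ℝ e (B ω) ≤ ρ ω ^ (4 * k + 10) * (δ ^ 2 * (‖e‖ * α)) := by
      calc inner ℝ e (B ω) ≤ ‖e‖ * ‖B ω‖ := real_inner_le_norm _ _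
        _ ≤ ‖e‖ * (ρ ω ^ (4 * k + 10) * (δ ^ 2 * α)) := by
          gcongr
          exact (hB ω).mono_exp (hρ ω) (by omega)
        _ = _ := by ring
    have h4 := norm_add_pow_four_le e (M ω + B ω)
    rw [inner_add_right] at h4
    have h5 : ‖e‖ ^ 3 * α ≤ ‖e‖ ^ 4 + α ^ 4 := by
      have ha := sq_nonneg (‖e‖ ^ 2 - ‖e‖ * α)
      have hb := sq_nonneg (‖e‖ ^ 2 - α ^ 2)
      nlinarith [sq_nonneg (‖e‖ ^ 2), sq_nonneg (α ^ 2)]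
    have h6 : ‖e‖ ^ 2 * α ^ 2 ≤ (‖e‖ ^ 4 + α ^ 4) / 2 := by
      nlinarith [sq_nonneg (‖e‖ ^ 2 - α ^ 2)]
    have h7 : 4 * (‖e‖ ^ 3 * α) + 8 * (‖e‖ ^ 2 * α ^ 2) + 3 * α ^ 4 ≤
        15 * (‖e‖ ^ 4 + α ^ 4) := by
      have : 0 ≤ ‖e‖ ^ 4 := by positivity
      have : 0 ≤ α ^ 4 := by positivity
      linarith
    calc ‖e + (M ω + B ω)‖ ^ 4 ≤ _ := h4
      _ = ‖e‖ ^ 4 + 4 * ‖e‖ ^ 2 * inner ℝ e (M ω) + (4 * ‖e‖ ^ 2 * inner ℝ e (B ω) +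
        8 * ‖e‖ ^ 2 * ‖M ω + B ω‖ ^ 2 + 3 * ‖M ω + B ω‖ ^ 4) := by ring
      _ ≤ ‖e‖ ^ 4 + 4 * ‖e‖ ^ 2 * inner ℝ e (M ω) +
        (4 * ‖e‖ ^ 2 * (ρ ω ^ (4 * k + 10) * (δ ^ 2 * (‖e‖ * α))) +
        8 * ‖e‖ ^ 2 * (ρ ω ^ (4 * k + 10) * (δ ^ 2 * α ^ 2)) +
        3 * (ρ ω ^ (4 * k + 10) * (δ ^ 2 * α ^ 4))) := by gcongr
      _ = ‖e‖ ^ 4 + 4 * ‖e‖ ^ 2 * inner ℝ e (M ω) + ρ ω ^ (4 * k + 10) * (δ ^ 2 *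
        (4 * (‖e‖ ^ 3 * α) + 8 * (‖e‖ ^ 2 * α ^ 2) + 3 * α ^ 4)) := by ring
      _ ≤ ‖e‖ ^ 4 + 4 * ‖e‖ ^ 2 * inner ℝ e (M ω) + ρ ω ^ (4 * k + 10) * (δ ^ 2 *
        (15 * (‖e‖ ^ 4 + α ^ 4))) := by gcongr
      _ = _ := by ring
  calc ∫ ω, ‖e + (M ω + B ω)‖ ^ 4 ∂ν ≤ ∫ ω, (‖e‖ ^ 4 + 4 * ‖e‖ ^ 2 * inner ℝ e (M ω) +
      ρ ω ^ (4 * k + 10) * (15 * δ ^ 2 * (‖e‖ ^ 4 + α ^ 4))) ∂ν :=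
        integral_mono (hint _) (hint _) key
    _ = ‖e‖ ^ 4 + (∫ ω, ρ ω ^ (4 * k + 10) ∂ν) * (15 * δ ^ 2 * (‖e‖ ^ 4 + α ^ 4)) := by
      have := h0 (innerSL ℝ e)
      simp only [innerSL_apply_apply] at this
      rw [integral_add (hint _) (hint _), integral_add (hint _) (hint _), integral_const_mul,
        integral_mul_const, this]
      simp
    _ ≤ _ := by gcongr

end Moments

/-! ### Expansion of two fine steps and of one coarse step. -/

section Milstein

variable {d m : ℕ} {μ : EuclideanSpace ℝ (Fin d) → EuclideanSpace ℝ (Fin d)}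
  {σ : Fin m → EuclideanSpace ℝ (Fin d) → EuclideanSpace ℝ (Fin d)}
  {Ω : Matrix (Fin m) (Fin m) ℝ}

/-- The vector `σ_j'(x) σ_k(x)`. -/
def milsteinCoeff (σ : Fin m → EuclideanSpace ℝ (Fin d) → EuclideanSpace ℝ (Fin d))
    (x : EuclideanSpace ℝ (Fin d)) (j k : Fin m) : EuclideanSpace ℝ (Fin d) :=
  fderiv ℝ (σ j) x (σ k x)

/-- The centred quadratic increment `z_j z_k - Ω_jk δ²`. -/
def quadIncr (Ω : Matrix (Fin m) (Fin m) ℝ) (δ : ℝ) (z : Fin m → ℝ) (j k : Fin m) : ℝ :=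
  z j * z k - Ω j k * δ ^ 2

/-- The quadratic increment generated by two successive steps with increments `z` and `w`. -/
def pairIncr (Ω : Matrix (Fin m) (Fin m) ℝ) (δ : ℝ) (z w : Fin m → ℝ) : Fin m → Fin m → ℝ :=
  (1 / 2 : ℝ) • quadIncr Ω δ z + ((1 / 2 : ℝ) • quadIncr Ω δ w + fun j k => w j * z k)

/-- `ρ` dominates all constants, the step `δ` and the normalized increments. -/
structure IsScale (Ω : Matrix (Fin m) (Fin m) ℝ) (κ δ : ℝ) (z w : Fin m → ℝ) (ρ : ℝ) : Prop where
  four_le : 4 ≤ ρ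
  const_le : κ ≤ ρ
  step_pos : 0 < δ
  step_le : δ ≤ ρ
  corr_le : ∑ j, ∑ k, |Ω j k| ≤ ρ
  fst_le : ∑ j, |z j| ≤ δ * ρ
  snd_le : ∑ j, |w j| ≤ δ * ρ

lemma IsScale.swap {κ δ ρ : ℝ} {z w : Fin m → ℝ} (h : IsScale Ω κ δ z w ρ) :
    IsScale Ω κ δ w z ρ :=
  ⟨h.1, h.2, h.3, h.4, h.5, h.7, h.6⟩

lemma milsteinStep_eq (h : ℝ) (x : EuclideanSpace ℝ (Fin d)) (z : Fin m → ℝ) :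
    milsteinStep μ σ Ω h x z = x + h • μ x + lin (fun j => σ j x) z
      + (1 / 2 : ℝ) • quad (milsteinCoeff σ x) (fun j k => z j * z k - Ω j k * h) := rfl

/-- The centred part of the remainder of two successive steps. -/
def centredRem (μ : EuclideanSpace ℝ (Fin d) → EuclideanSpace ℝ (Fin d))
    (σ : Fin m → EuclideanSpace ℝ (Fin d) → EuclideanSpace ℝ (Fin d))
    (Ω : Matrix (Fin m) (Fin m) ℝ) (δ : ℝ) (x : EuclideanSpace ℝ (Fin d)) (z w : Fin m → ℝ) :
    EuclideanSpace ℝ (Fin d) :=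
  lin (fun j => σ j (milsteinStep μ σ Ω (δ ^ 2) x z) - σ j x - lin (milsteinCoeff σ x j) z) w
  + (1 / 2 : ℝ) • quad (fun j k => milsteinCoeff σ (milsteinStep μ σ Ω (δ ^ 2) x z) j k
      - milsteinCoeff σ x j k) (quadIncr Ω δ w)
  + δ ^ 2 • fderiv ℝ μ x (lin (fun j => σ j x) z
      + (1 / 2 : ℝ) • quad (milsteinCoeff σ x) (quadIncr Ω δ z))

/-- The remainder of two successive steps that is not centred. -/
def driftRem (μ : EuclideanSpace ℝ (Fin d) → EuclideanSpace ℝ (Fin d))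
    (σ : Fin m → EuclideanSpace ℝ (Fin d) → EuclideanSpace ℝ (Fin d))
    (Ω : Matrix (Fin m) (Fin m) ℝ) (δ : ℝ) (x : EuclideanSpace ℝ (Fin d)) (z : Fin m → ℝ) :
    EuclideanSpace ℝ (Fin d) :=
  δ ^ 2 • (μ (milsteinStep μ σ Ω (δ ^ 2) x z) - μ x - fderiv ℝ μ x (lin (fun j => σ j x) z
      + (1 / 2 : ℝ) • quad (milsteinCoeff σ x) (quadIncr Ω δ z)))

/-- Expanding σ_j at the intermediate point to first order in the noise produces the cross term w_j
z_k of `pairIncr`, the only place where the order of the increments matters at leading order. All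
further corrections go to the two remainders, so that the identity is purely algebraic. -/
lemma twoStep_eq (δ : ℝ) (x : EuclideanSpace ℝ (Fin d)) (z w : Fin m → ℝ) :
    milsteinStep μ σ Ω (δ ^ 2) (milsteinStep μ σ Ω (δ ^ 2) x z) w =
      x + (2 * δ ^ 2) • μ x + (lin (fun j => σ j x) z + lin (fun j => σ j x) w)
      + quad (milsteinCoeff σ x) (pairIncr Ω δ z w)
      + centredRem μ σ Ω δ x z w + driftRem μ σ Ω δ x z := by
  have h1 := milsteinStep_eq (μ := μ) (σ := σ) (Ω := Ω) (δ ^ 2) x z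
  rw [milsteinStep_eq, centredRem, driftRem, lin_sub_left, lin_sub_left, quad_sub_left, lin_lin,
    pairIncr, quad_add_right, quad_add_right, quad_smul_right, quad_smul_right]
  change _ = _ + (1 / 2 : ℝ) • quad (milsteinCoeff σ x) (fun j k => z j * z k - Ω j k * δ ^ 2)
    at h1
  set y := milsteinStep μ σ Ω (δ ^ 2) x z
  have e1 : (fun j k => w j * w k - Ω j k * δ ^ 2) = quadIncr Ω δ w := rfl
  have e2 : (fun j k => z j * z k - Ω j k * δ ^ 2) = quadIncr Ω δ z := rfl
  rw [e1]
  rw [e2] at h1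
  -- Only the base point of the second step is expanded; inside the coefficients `y` remains an
  -- atom.
  nth_rewrite 1 [h1]
  module

/-- The coarse quadratic increment of z + w is the sum of `pairIncr` over both orders. Hence the
coarse step has exactly the average of the leading noise of the fine and antithetic steps. -/
lemma coarseStep_eq (δ : ℝ) (x : EuclideanSpace ℝ (Fin d)) (z w : Fin m → ℝ) :
    milsteinStep μ σ Ω (2 * δ ^ 2) x (z + w) =
      x + (2 * δ ^ 2) • μ x + (lin (fun j => σ j x) z + lin (fun j => σ j x) w)
      + ((1 / 2 : ℝ) • quad (milsteinCoeff σ x) (pairIncr Ω δ z w)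
        + (1 / 2 : ℝ) • quad (milsteinCoeff σ x) (pairIncr Ω δ w z)) := by
  rw [milsteinStep_eq, lin_add_right, ← smul_add, ← quad_add_right]
  congr 3
  ext j k
  simp only [pairIncr, quadIncr, Pi.add_apply, Pi.smul_apply, smul_eq_mul]
  ring

/-! ### Pathwise bounds of coefficients, steps and remainders. -/

section Pointwise

variable {κ δ ρ : ℝ} {z w : Fin m → ℝ} (hs : IsScale Ω κ δ z w ρ)
include hs

lemma IsScale.bd_of_growth {F : Type*} [NormedAddCommGroup F] [NormedSpace ℝ F]
    {g : EuclideanSpace ℝ (Fin d) → F} (hg : C2Bounds κ g) (x : EuclideanSpace ℝ (Fin d)) :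
    Bd ρ 1 (1 + ‖x‖) (g x) := by
  refine (hg.growth x).trans ?_
  rw [pow_one]
  gcongr
  exact hs.const_le

lemma IsScale.bd_of_lip {F : Type*} [NormedAddCommGroup F] [NormedSpace ℝ F]
    {g : EuclideanSpace ℝ (Fin d) → F} (hg : C2Bounds κ g) (x y : EuclideanSpace ℝ (Fin d)) :
    Bd ρ 1 ‖x - y‖ (g x - g y) := by
  refine (hg.lip x y).trans ?_
  rw [pow_one]
  gcongr
  exact hs.const_le

lemma IsScale.bd_of_taylor {F : Type*} [NormedAddCommGroup F] [NormedSpace ℝ F]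
    {g : EuclideanSpace ℝ (Fin d) → F} (hg : C2Bounds κ g) (x y : EuclideanSpace ℝ (Fin d)) :
    Bd ρ 1 (‖y - x‖ ^ 2) (g y - g x - fderiv ℝ g x (y - x)) := by
  refine (hg.taylor x y).trans ?_
  rw [pow_one]
  gcongr
  exact hs.const_le

lemma IsScale.bd_milsteinCoeff (hσ : ∀ j, C2Bounds κ (σ j)) (x : EuclideanSpace ℝ (Fin d))
    (j k : Fin m) : Bd ρ 2 (1 + ‖x‖) (milsteinCoeff σ x j k) :=
  (hs.bd_of_growth (hσ k) x).clm hs.four_le ((hσ j).fderiv_le x) hs.const_le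

/-- Product rule: the change of σ_k is met by a bounded derivative, but the change of σ_j' is met by
σ_k(y), which grows linearly. The coefficient is therefore not globally Lipschitz, whence the weight
1 + ‖y‖. -/
lemma IsScale.bd_milsteinCoeff_sub (hσ : ∀ j, C2Bounds κ (σ j)) (x y : EuclideanSpace ℝ (Fin d))
    (j k : Fin m) :
    Bd ρ 3 (‖x - y‖ * (1 + ‖y‖)) (milsteinCoeff σ x j k - milsteinCoeff σ y j k) := by
  have h4 := hs.four_le
  have e : milsteinCoeff σ x j k - milsteinCoeff σ y j k =
      fderiv ℝ (σ j) x (σ k x - σ k y) + (fderiv ℝ (σ j) x - fderiv ℝ (σ j) y) (σ k y) := by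
    simp [milsteinCoeff]
  rw [e]
  refine Bd.add h4 (n := 2) ?_ ?_
  · refine ((hs.bd_of_lip (hσ k) x y).clm h4 ((hσ j).fderiv_le x) hs.const_le).mono h4 ?_
    nlinarith [norm_nonneg (x - y), norm_nonneg y]
  · refine (ContinuousLinearMap.le_opNorm _ _).trans ?_
    have h1 := (hσ j).fderiv_lip x y
    have h2 := (hσ k).growth y
    have h3 := hs.const_le
    calc _ ≤ (ρ * ‖x - y‖) * (ρ * (1 + ‖y‖)) := by
          gcongr
          · exact h1.trans (by gcongr)
          · exact h2.trans (by gcongr)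
      _ = _ := by ring

lemma IsScale.sum_quadIncr_le : ∑ j, ∑ k, |quadIncr Ω δ z j k| ≤ δ ^ 2 * ρ ^ 3 := by
  have h4 := hs.four_le
  have hz := hs.fst_le
  have h0 : 0 ≤ ∑ j, |z j| := by positivity
  calc ∑ j, ∑ k, |quadIncr Ω δ z j k| ≤ ∑ j, ∑ k, (|z j| * |z k| + |Ω j k| * δ ^ 2) := by
        refine Finset.sum_le_sum fun j _ => Finset.sum_le_sum fun k _ => ?_
        refine (abs_sub _ _).trans (le_of_eq ?_)
        rw [abs_mul, abs_mul, abs_of_nonneg (sq_nonneg δ)]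
    _ = (∑ j, |z j|) * (∑ k, |z k|) + (∑ j, ∑ k, |Ω j k|) * δ ^ 2 := by
        simp_rw [Finset.sum_add_distrib, Finset.sum_mul_sum, Finset.sum_mul]
    _ ≤ (δ * ρ) * (δ * ρ) + ρ * δ ^ 2 := by
        have := hs.corr_le
        have := hs.step_pos
        gcongr
    _ = δ ^ 2 * (ρ ^ 2 + ρ) := by ring
    _ ≤ _ := by gcongr; nlinarith

lemma IsScale.sum_pairIncr_le : ∑ j, ∑ k, |pairIncr Ω δ z w j k| ≤ δ ^ 2 * ρ ^ 4 := by
  have h4 := hs.four_le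
  have hz := hs.fst_le
  have hw := hs.snd_le
  have h0 : 0 ≤ ∑ j, |z j| := by positivity
  have h1 := hs.sum_quadIncr_le
  have h2 := hs.swap.sum_quadIncr_le
  calc ∑ j, ∑ k, |pairIncr Ω δ z w j k| ≤ ∑ j, ∑ k, ((1 / 2) * |quadIncr Ω δ z j k| +
          ((1 / 2) * |quadIncr Ω δ w j k| + |w j| * |z k|)) := by
        refine Finset.sum_le_sum fun j _ => Finset.sum_le_sum fun k _ => ?_
        simp only [pairIncr, Pi.add_apply, Pi.smul_apply, smul_eq_mul]
        refine (abs_add_le _ _).trans (add_le_add ?_ ((abs_add_le _ _).trans (add_le_add ?_ ?_)))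
        · rw [abs_mul]; norm_num
        · rw [abs_mul]; norm_num
        · rw [abs_mul]
    _ = (1 / 2) * (∑ j, ∑ k, |quadIncr Ω δ z j k|) + ((1 / 2) * (∑ j, ∑ k, |quadIncr Ω δ w j k|)
          + (∑ j, |w j|) * (∑ k, |z k|)) := by
        simp_rw [Finset.sum_add_distrib, Finset.sum_mul_sum, Finset.mul_sum]
    _ ≤ (1 / 2) * (δ ^ 2 * ρ ^ 3) + ((1 / 2) * (δ ^ 2 * ρ ^ 3) + (δ * ρ) * (δ * ρ)) := by
        have := hs.step_pos
        gcongr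
    _ = δ ^ 2 * (ρ ^ 2 * (ρ + 1)) := by ring
    _ ≤ δ ^ 2 * (ρ ^ 2 * ρ ^ 2) := by gcongr; nlinarith
    _ = _ := by ring

lemma IsScale.bd_quad_pairIncr {v : Fin m → Fin m → EuclideanSpace ℝ (Fin d)} {n : ℕ} {a : ℝ}
    (ha : 0 ≤ a) (hv : ∀ j k, Bd ρ n a (v j k)) :
    Bd ρ (n + 4) (δ ^ 2 * a) (quad v (pairIncr Ω δ z w)) :=
  Bd.quad hs.four_le ha hv hs.sum_pairIncr_le

lemma IsScale.bd_quad_quadIncr {v : Fin m → Fin m → EuclideanSpace ℝ (Fin d)} {n : ℕ} {a : ℝ}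
    (ha : 0 ≤ a) (hv : ∀ j k, Bd ρ n a (v j k)) :
    Bd ρ (n + 3) (δ ^ 2 * a) (quad v (quadIncr Ω δ z)) :=
  Bd.quad hs.four_le ha hv hs.sum_quadIncr_le

/-- One power of the step size can be traded for a power of the scale. -/
lemma IsScale.drop_step {E : Type*} [NormedAddCommGroup E] {n : ℕ} {a b : ℝ} {v : E}
    (h : Bd ρ n a v) (hb : 0 ≤ b) (hab : a ≤ δ * b) : Bd ρ (n + 1) b v :=
  h.absorb hs.four_le 1 (hab.trans (by rw [pow_one]; gcongr; exact hs.step_le))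

lemma IsScale.bd_noise (hσ : ∀ j, C2Bounds κ (σ j)) (x : EuclideanSpace ℝ (Fin d)) :
    Bd ρ 7 (δ * (1 + ‖x‖)) (lin (fun j => σ j x) z
      + (1 / 2 : ℝ) • quad (milsteinCoeff σ x) (quadIncr Ω δ z)) := by
  have h4 := hs.four_le
  have hδ := hs.step_pos
  refine Bd.add h4 (n := 6) ?_ ?_
  · exact (Bd.lin h4 (by positivity) (fun j => hs.bd_of_growth (hσ j) x) hs.fst_le).mono_exp h4
      (by norm_num)
  · refine Bd.smul_of_le_one ?_ (by norm_num [abs_of_pos])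
    refine hs.drop_step (hs.bd_quad_quadIncr (by positivity) (hs.bd_milsteinCoeff hσ x))
      (by positivity) (le_of_eq (by ring))

lemma IsScale.bd_drift (hμ : C2Bounds κ μ) (x : EuclideanSpace ℝ (Fin d)) :
    Bd ρ 1 (δ ^ 2 * (1 + ‖x‖)) (δ ^ 2 • μ x) :=
  (hs.bd_of_growth hμ x).smul (by rw [abs_of_nonneg (sq_nonneg δ)])

lemma IsScale.bd_step (hμ : C2Bounds κ μ) (hσ : ∀ j, C2Bounds κ (σ j))
    (x : EuclideanSpace ℝ (Fin d)) :
    Bd ρ 8 (δ * (1 + ‖x‖)) (milsteinStep μ σ Ω (δ ^ 2) x z - x) := by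
  have h4 := hs.four_le
  have hδ := hs.step_pos
  have e : milsteinStep μ σ Ω (δ ^ 2) x z - x = δ ^ 2 • μ x + (lin (fun j => σ j x) z
      + (1 / 2 : ℝ) • quad (milsteinCoeff σ x) (quadIncr Ω δ z)) := by
    rw [milsteinStep_eq]
    change _ + (1 / 2 : ℝ) • quad (milsteinCoeff σ x) (quadIncr Ω δ z) - x = _
    module
  rw [e]
  refine Bd.add h4 (n := 7) ?_ (hs.bd_noise hσ x)
  exact (hs.drop_step (hs.bd_drift hμ x) (by positivity) (le_of_eq (by ring))).mono_exp h4
    (by norm_num)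

lemma IsScale.bd_taylor_step {F : Type*} [NormedAddCommGroup F] [NormedSpace ℝ F]
    {g : EuclideanSpace ℝ (Fin d) → F} (hg : C2Bounds κ g)
    (hμ : C2Bounds κ μ) (hσ : ∀ j, C2Bounds κ (σ j)) (x : EuclideanSpace ℝ (Fin d)) :
    Bd ρ 17 (δ ^ 2 * (1 + ‖x‖) ^ 2) (g (milsteinStep μ σ Ω (δ ^ 2) x z) - g x
      - fderiv ℝ g x (milsteinStep μ σ Ω (δ ^ 2) x z - x)) := by
  have h4 := hs.four_le
  refine (hs.bd_of_taylor hg x _).absorb h4 16 ?_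
  have h := hs.bd_step hμ hσ x
  calc _ ≤ (ρ ^ 8 * (δ * (1 + ‖x‖))) ^ 2 := by
        unfold Bd at h
        gcongr
    _ = _ := by ring

lemma IsScale.bd_lip_step {F : Type*} [NormedAddCommGroup F] [NormedSpace ℝ F]
    {g : EuclideanSpace ℝ (Fin d) → F} (hg : C2Bounds κ g)
    (hμ : C2Bounds κ μ) (hσ : ∀ j, C2Bounds κ (σ j)) (x : EuclideanSpace ℝ (Fin d)) :
    Bd ρ 9 (δ * (1 + ‖x‖)) (g (milsteinStep μ σ Ω (δ ^ 2) x z) - g x) :=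
  (hs.bd_of_lip hg _ x).absorb hs.four_le 8 (hs.bd_step hμ hσ x)

omit hs in
lemma le_sq_of_one_le {c s : ℝ} (hc : 0 ≤ c) (hs : 1 ≤ s) : c * s ≤ c * s ^ 2 := by
  gcongr; nlinarith

/-- The subtracted linear term is σ_j'(x) applied to the part of the step that is linear in `z`. The
rest of the step is already of order δ², as is the Taylor error. -/
lemma IsScale.bd_diffusionRem (hμ : C2Bounds κ μ) (hσ : ∀ j, C2Bounds κ (σ j))
    (x : EuclideanSpace ℝ (Fin d)) (j : Fin m) :
    Bd ρ 18 (δ ^ 2 * (1 + ‖x‖) ^ 2) (σ j (milsteinStep μ σ Ω (δ ^ 2) x z) - σ j x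
      - lin (milsteinCoeff σ x j) z) := by
  have h4 := hs.four_le
  have hδ := hs.step_pos
  have e : σ j (milsteinStep μ σ Ω (δ ^ 2) x z) - σ j x - lin (milsteinCoeff σ x j) z =
      (σ j (milsteinStep μ σ Ω (δ ^ 2) x z) - σ j x
        - fderiv ℝ (σ j) x (milsteinStep μ σ Ω (δ ^ 2) x z - x))
      + fderiv ℝ (σ j) x (δ ^ 2 • μ x
        + (1 / 2 : ℝ) • quad (milsteinCoeff σ x) (quadIncr Ω δ z)) := by
    have e1 : milsteinStep μ σ Ω (δ ^ 2) x z - x = lin (fun j => σ j x) z + (δ ^ 2 • μ x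
        + (1 / 2 : ℝ) • quad (milsteinCoeff σ x) (quadIncr Ω δ z)) := by
      rw [milsteinStep_eq]
      change _ + (1 / 2 : ℝ) • quad (milsteinCoeff σ x) (quadIncr Ω δ z) - x = _
      module
    have e2 : lin (milsteinCoeff σ x j) z = fderiv ℝ (σ j) x (lin (fun j => σ j x) z) := by
      rw [map_lin]; rfl
    rw [e1, e2, map_add (fderiv ℝ (σ j) x) (lin _ _)]
    abel
  rw [e]
  refine Bd.add h4 (n := 17) (hs.bd_taylor_step (hσ j) hμ hσ x) ?_
  have h1 : Bd ρ 6 (δ ^ 2 * (1 + ‖x‖)) (δ ^ 2 • μ x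
        + (1 / 2 : ℝ) • quad (milsteinCoeff σ x) (quadIncr Ω δ z)) := by
    refine Bd.add h4 (n := 5) ((hs.bd_drift hμ x).mono_exp h4 (by norm_num)) ?_
    exact (hs.bd_quad_quadIncr (by positivity) (hs.bd_milsteinCoeff hσ x)).smul_of_le_one
      (by norm_num [abs_of_pos])
  refine ((h1.clm h4 ((hσ j).fderiv_le x) hs.const_le).mono h4 ?_).mono_exp h4 (by norm_num)
  exact le_sq_of_one_le (by positivity) (by linarith [norm_nonneg x])

/-- The crude bounds lose one power of δ but stay linear in 1 + ‖x‖. The fourth-moment estimates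
need this: the sharp bounds, quadratic in the state, would call for eighth powers there. The sharp
ones serve the second moment of the midpoint error. -/
lemma IsScale.bd_diffusionRem_crude (hμ : C2Bounds κ μ) (hσ : ∀ j, C2Bounds κ (σ j))
    (x : EuclideanSpace ℝ (Fin d)) (j : Fin m) :
    Bd ρ 10 (δ * (1 + ‖x‖)) (σ j (milsteinStep μ σ Ω (δ ^ 2) x z) - σ j x
      - lin (milsteinCoeff σ x j) z) := by
  have h4 := hs.four_le
  refine Bd.sub h4 (n := 9) (hs.bd_lip_step (hσ j) hμ hσ x) ?_
  exact (Bd.lin h4 (by positivity) (fun k => hs.bd_milsteinCoeff hσ x j k) hs.fst_le).mono_exp h4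
    (by norm_num)

lemma IsScale.bd_coeffRem (hμ : C2Bounds κ μ) (hσ : ∀ j, C2Bounds κ (σ j))
    (x : EuclideanSpace ℝ (Fin d)) (j k : Fin m) :
    Bd ρ 11 (δ * (1 + ‖x‖) ^ 2) (milsteinCoeff σ (milsteinStep μ σ Ω (δ ^ 2) x z) j k
      - milsteinCoeff σ x j k) := by
  refine (hs.bd_milsteinCoeff_sub hσ _ x j k).absorb hs.four_le 8 ?_
  have h := hs.bd_step hμ hσ x
  calc _ ≤ (ρ ^ 8 * (δ * (1 + ‖x‖))) * (1 + ‖x‖) := by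
        unfold Bd at h
        gcongr
    _ = _ := by ring

lemma IsScale.bd_coeffRem_crude (hμ : C2Bounds κ μ) (hσ : ∀ j, C2Bounds κ (σ j))
    (x : EuclideanSpace ℝ (Fin d)) (j k : Fin m) :
    Bd ρ 13 (1 + ‖x‖) (milsteinCoeff σ (milsteinStep μ σ Ω (δ ^ 2) x z) j k
      - milsteinCoeff σ x j k) := by
  have h4 := hs.four_le
  refine Bd.sub h4 (n := 12) ?_ ((hs.bd_milsteinCoeff hσ x j k).mono_exp h4 (by norm_num))
  refine (hs.bd_milsteinCoeff hσ _ j k).absorb h4 10 ?_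
  set y := milsteinStep μ σ Ω (δ ^ 2) x z
  have h : ‖y - x‖ ≤ ρ ^ 8 * (δ * (1 + ‖x‖)) := hs.bd_step hμ hσ x
  have h5 : ‖y‖ ≤ ‖x‖ + ‖y - x‖ := by
    have := norm_add_le x (y - x)
    rwa [add_sub_cancel] at this
  have h6 : ρ ^ 8 * (δ * (1 + ‖x‖)) ≤ ρ ^ 9 * (1 + ‖x‖) := by
    calc ρ ^ 8 * (δ * (1 + ‖x‖)) ≤ ρ ^ 8 * (ρ * (1 + ‖x‖)) := by
          gcongr; exact hs.step_le
      _ = _ := by ring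
  have h7 : 1 + ρ ^ 9 ≤ ρ ^ 10 := by
    have : 1 ≤ ρ ^ 9 := one_le_pow₀ (by linarith)
    have : ρ ^ 10 = ρ * ρ ^ 9 := by ring
    nlinarith
  nlinarith [norm_nonneg x]

lemma IsScale.bd_centredRem (hμ : C2Bounds κ μ) (hσ : ∀ j, C2Bounds κ (σ j))
    (x : EuclideanSpace ℝ (Fin d)) :
    Bd ρ 21 (δ ^ 3 * (1 + ‖x‖) ^ 2) (centredRem μ σ Ω δ x z w) := by
  have h4 := hs.four_le
  have hδ := hs.step_pos
  refine Bd.add h4 (n := 20) (Bd.add h4 (n := 19) ?_ ?_) ?_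
  · exact (Bd.lin h4 (by positivity) (fun j => hs.bd_diffusionRem hμ hσ x j) hs.snd_le).mono h4
      (le_of_eq (by ring))
  · refine Bd.smul_of_le_one ?_ (by norm_num [abs_of_pos])
    exact ((hs.swap.bd_quad_quadIncr (by positivity) (hs.bd_coeffRem hμ hσ x)).mono h4
      (le_of_eq (by ring))).mono_exp h4 (by norm_num)
  · refine ((((hs.bd_noise hσ x).clm h4 (hμ.fderiv_le x) hs.const_le).smul
      (c := δ ^ 2) (by rw [abs_of_nonneg (sq_nonneg δ)])).mono h4 ?_).mono_exp h4 (by norm_num)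
    calc δ ^ 2 * (δ * (1 + ‖x‖)) = δ ^ 3 * (1 + ‖x‖) := by ring
      _ ≤ _ := le_sq_of_one_le (by positivity) (by linarith [norm_nonneg x])

lemma IsScale.bd_centredRem_crude (hμ : C2Bounds κ μ) (hσ : ∀ j, C2Bounds κ (σ j))
    (x : EuclideanSpace ℝ (Fin d)) :
    Bd ρ 21 (δ ^ 2 * (1 + ‖x‖)) (centredRem μ σ Ω δ x z w) := by
  have h4 := hs.four_le
  have hδ := hs.step_pos
  refine Bd.add h4 (n := 20) (Bd.add h4 (n := 19) ?_ ?_) ?_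
  · exact ((Bd.lin h4 (by positivity) (fun j => hs.bd_diffusionRem_crude hμ hσ x j)
      hs.snd_le).mono h4 (le_of_eq (by ring))).mono_exp h4 (by norm_num)
  · refine Bd.smul_of_le_one ?_ (by norm_num [abs_of_pos])
    exact (hs.swap.bd_quad_quadIncr (by positivity)
      (hs.bd_coeffRem_crude hμ hσ x)).mono_exp h4 (by norm_num)
  · exact (hs.drop_step (((hs.bd_noise hσ x).clm h4 (hμ.fderiv_le x) hs.const_le).smul
      (c := δ ^ 2) (by rw [abs_of_nonneg (sq_nonneg δ)])) (by positivity)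
      (le_of_eq (by ring))).mono_exp h4 (by norm_num)

/-- The response of μ to the noise, of order δ, is centred and has been moved to `centredRem`. Only
a Taylor error and the drift's effect on itself are left, both of order δ² before the prefactor δ².
-/
lemma IsScale.bd_driftRem (hμ : C2Bounds κ μ) (hσ : ∀ j, C2Bounds κ (σ j))
    (x : EuclideanSpace ℝ (Fin d)) :
    Bd ρ 18 (δ ^ 4 * (1 + ‖x‖) ^ 2) (driftRem μ σ Ω δ x z) := by
  have h4 := hs.four_le
  have hδ := hs.step_pos
  have e : μ (milsteinStep μ σ Ω (δ ^ 2) x z) - μ x - fderiv ℝ μ x (lin (fun j => σ j x) z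
      + (1 / 2 : ℝ) • quad (milsteinCoeff σ x) (quadIncr Ω δ z)) =
      (μ (milsteinStep μ σ Ω (δ ^ 2) x z) - μ x
        - fderiv ℝ μ x (milsteinStep μ σ Ω (δ ^ 2) x z - x))
      + fderiv ℝ μ x (δ ^ 2 • μ x) := by
    have e1 : milsteinStep μ σ Ω (δ ^ 2) x z - x = (lin (fun j => σ j x) z
        + (1 / 2 : ℝ) • quad (milsteinCoeff σ x) (quadIncr Ω δ z)) + δ ^ 2 • μ x := by
      rw [milsteinStep_eq]
      change _ + (1 / 2 : ℝ) • quad (milsteinCoeff σ x) (quadIncr Ω δ z) - x = _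
      module
    rw [e1, map_add (fderiv ℝ μ x) (_ + _)]
    abel
  have h1 : Bd ρ 18 (δ ^ 2 * (1 + ‖x‖) ^ 2) (μ (milsteinStep μ σ Ω (δ ^ 2) x z) - μ x
      - fderiv ℝ μ x (lin (fun j => σ j x) z
      + (1 / 2 : ℝ) • quad (milsteinCoeff σ x) (quadIncr Ω δ z))) := by
    rw [e]
    refine Bd.add h4 (n := 17) (hs.bd_taylor_step hμ hμ hσ x) ?_
    exact (((hs.bd_drift hμ x).clm h4 (hμ.fderiv_le x) hs.const_le).mono h4
      (le_sq_of_one_le (by positivity) (by linarith [norm_nonneg x]))).mono_exp h4 (by norm_num)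
  exact (h1.smul (c := δ ^ 2) (by rw [abs_of_nonneg (sq_nonneg δ)])).mono h4 (le_of_eq (by ring))

lemma IsScale.bd_driftRem_crude (hμ : C2Bounds κ μ) (hσ : ∀ j, C2Bounds κ (σ j))
    (x : EuclideanSpace ℝ (Fin d)) :
    Bd ρ 18 (δ ^ 3 * (1 + ‖x‖)) (driftRem μ σ Ω δ x z) := by
  have h4 := hs.four_le
  have hδ := hs.step_pos
  refine ((((hs.bd_lip_step hμ hμ hσ x).sub h4 (((hs.bd_noise hσ x).clm h4 (hμ.fderiv_le x)
    hs.const_le).mono_exp h4 (by norm_num))).smul (c := δ ^ 2)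
    (by rw [abs_of_nonneg (sq_nonneg δ)])).mono h4 (le_of_eq (by ring))).mono_exp h4 (by norm_num)

/-- A regular function at the midpoint of two points, compared with its value at `y`. -/
lemma IsScale.bd_average {F : Type*} [NormedAddCommGroup F] [NormedSpace ℝ F]
    {g : EuclideanSpace ℝ (Fin d) → F} (hg : C2Bounds κ g) {β : ℝ}
    (x x' y : EuclideanSpace ℝ (Fin d)) (h1 : ‖(1 / 2 : ℝ) • (x + x') - y‖ ≤ β)
    (h2 : ‖x - y‖ ^ 2 ≤ β) (h3 : ‖x' - y‖ ^ 2 ≤ β) :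
    Bd ρ 3 β ((1 / 2 : ℝ) • g x + (1 / 2 : ℝ) • g x' - g y) := by
  have h4 := hs.four_le
  -- Linearizing at `y` at both points makes the first-order terms depend on the midpoint error
  -- alone; x − y and x' − y enter only through their squares.
  have e : (1 / 2 : ℝ) • g x + (1 / 2 : ℝ) • g x' - g y =
      ((1 / 2 : ℝ) • (g x - g y - fderiv ℝ g y (x - y))
        + (1 / 2 : ℝ) • (g x' - g y - fderiv ℝ g y (x' - y)))
      + fderiv ℝ g y ((1 / 2 : ℝ) • (x + x') - y) := by
    simp only [map_sub, map_smul, map_add]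
    module
  rw [e]
  have ht : |(1 / 2 : ℝ)| ≤ 1 := by norm_num [abs_of_pos]
  refine Bd.add h4 (n := 2) (Bd.add h4 (n := 1) ?_ ?_) ?_
  · exact ((hs.bd_of_taylor hg y x).mono h4 h2).smul_of_le_one ht
  · exact ((hs.bd_of_taylor hg y x').mono h4 h3).smul_of_le_one ht
  · have h0 : Bd ρ 0 β ((1 / 2 : ℝ) • (x + x') - y) := by simpa [Bd] using h1
    exact (h0.clm h4 (hg.fderiv_le y) hs.const_le).mono_exp h4 (by norm_num)

end Pointwise

/-! ### Centring of the noise in one coarse step. -/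

/-- Two increments `z`, `w` with step `δ ^ 2`, each centred with covariance `δ ^ 2 Ω` given the
other, and with moments controlled by the scale `ρ`. -/
structure IsStepNoise {W : Type*} [MeasurableSpace W] (ν : Measure W)
    (Ω : Matrix (Fin m) (Fin m) ℝ) (κ δ C : ℝ) (z w : W → Fin m → ℝ) (ρ : W → ℝ) : Prop where
  integrable : ∀ g : W → ℝ, Integrable g ν
  scale : ∀ ω, IsScale Ω κ δ (z ω) (w ω) (ρ ω)
  lin_fst : ∀ (g : (Fin m → ℝ) → ℝ) (j : Fin m), ∫ ω, z ω j * g (w ω) ∂ν = 0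
  lin_snd : ∀ (g : (Fin m → ℝ) → ℝ) (j : Fin m), ∫ ω, w ω j * g (z ω) ∂ν = 0
  quad_fst : ∀ (g : (Fin m → ℝ) → ℝ) (j k : Fin m),
    ∫ ω, quadIncr Ω δ (z ω) j k * g (w ω) ∂ν = 0
  quad_snd : ∀ (g : (Fin m → ℝ) → ℝ) (j k : Fin m),
    ∫ ω, quadIncr Ω δ (w ω) j k * g (z ω) ∂ν = 0
  moment : ∫ ω, ρ ω ^ 200 ∂ν ≤ C

section Noise

variable {W : Type*} [MeasurableSpace W] {ν : Measure W} {κ δ C : ℝ} {z w : W → Fin m → ℝ}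
  {ρ : W → ℝ}

lemma IsStepNoise.swap (hn : IsStepNoise ν Ω κ δ C z w ρ) : IsStepNoise ν Ω κ δ C w z ρ where
  integrable := hn.integrable
  scale ω := (hn.scale ω).swap
  lin_fst := hn.lin_snd
  lin_snd := hn.lin_fst
  quad_fst := hn.quad_snd
  quad_snd := hn.quad_fst
  moment := hn.moment

variable {E : Type*} [NormedAddCommGroup E] [NormedSpace ℝ E]

lemma IsStepNoise.meanZero_lin_snd (hn : IsStepNoise ν Ω κ δ C z w ρ)
    (G : (Fin m → ℝ) → Fin m → E) : MeanZero ν (fun ω => lin (G (z ω)) (w ω)) := by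
  refine MeanZero.sum hn.integrable _ fun j _ φ => ?_
  simp only [map_smul, smul_eq_mul]
  exact hn.lin_snd (fun u => φ (G u j)) j

lemma IsStepNoise.meanZero_quad_snd (hn : IsStepNoise ν Ω κ δ C z w ρ)
    (G : (Fin m → ℝ) → Fin m → Fin m → E) :
    MeanZero ν (fun ω => quad (G (z ω)) (quadIncr Ω δ (w ω))) := by
  refine MeanZero.sum hn.integrable _ fun j _ => MeanZero.sum hn.integrable _ fun k _ φ => ?_
  simp only [map_smul, smul_eq_mul]
  exact hn.quad_snd (fun u => φ (G u j k)) j k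

lemma IsStepNoise.meanZero_lin (hn : IsStepNoise ν Ω κ δ C z w ρ) (v : Fin m → E) :
    MeanZero ν (fun ω => lin v (z ω) + lin v (w ω)) :=
  (hn.swap.meanZero_lin_snd fun _ => v).add hn.integrable (hn.meanZero_lin_snd fun _ => v)

lemma IsStepNoise.meanZero_pairIncr (hn : IsStepNoise ν Ω κ δ C z w ρ) (v : Fin m → Fin m → E) :
    MeanZero ν (fun ω => quad v (pairIncr Ω δ (z ω) (w ω))) := by
  simp only [pairIncr, quad_add_right, quad_smul_right, ← lin_lin]
  exact ((hn.swap.meanZero_quad_snd fun _ => v).smul _).add hn.integrable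
    (((hn.meanZero_quad_snd fun _ => v).smul _).add hn.integrable
      (hn.meanZero_lin_snd fun u j => lin (v j) u))

/-- The first two summands are linear or centred quadratic in the second increment, with
coefficients depending on the first only. The third is linear and centred quadratic in the first
increment, with coefficients frozen at `x`. -/
lemma IsStepNoise.meanZero_centredRem (hn : IsStepNoise ν Ω κ δ C z w ρ)
    (x : EuclideanSpace ℝ (Fin d)) :
    MeanZero ν (fun ω => centredRem μ σ Ω δ x (z ω) (w ω)) := by
  refine MeanZero.add hn.integrable (MeanZero.add hn.integrable ?_ (MeanZero.smul _ ?_))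
    (MeanZero.smul _ (MeanZero.clm _ (MeanZero.add hn.integrable ?_ (MeanZero.smul _ ?_))))
  · exact hn.meanZero_lin_snd fun u j => σ j (milsteinStep μ σ Ω (δ ^ 2) x u) - σ j x
      - lin (milsteinCoeff σ x j) u
  · exact hn.meanZero_quad_snd fun u j k => milsteinCoeff σ (milsteinStep μ σ Ω (δ ^ 2) x u) j k
      - milsteinCoeff σ x j k
  · exact hn.swap.meanZero_lin_snd fun _ j => σ j x
  · exact hn.swap.meanZero_quad_snd fun _ => milsteinCoeff σ x

lemma IsStepNoise.moment_le (hn : IsStepNoise ν Ω κ δ C z w ρ) {n : ℕ} (hk : n ≤ 200) :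
    ∫ ω, ρ ω ^ n ∂ν ≤ C := by
  refine le_trans (integral_mono (hn.integrable _) (hn.integrable _) fun ω => ?_) hn.moment
  exact pow_le_pow_right₀ (by linarith [(hn.scale ω).four_le]) hk

lemma IsStepNoise.const_nonneg (hn : IsStepNoise ν Ω κ δ C z w ρ) : 0 ≤ C :=
  (integral_nonneg fun ω => pow_nonneg (by linarith [(hn.scale ω).four_le]) _).trans hn.moment

lemma IsStepNoise.step_pos [IsProbabilityMeasure ν] (hn : IsStepNoise ν Ω κ δ C z w ρ) : 0 < δ :=
  (hn.scale (Classical.choice (nonempty_of_isProbabilityMeasure ν))).step_pos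

end Noise

section Pointwise

variable {κ δ ρ : ℝ} {z w : Fin m → ℝ} (hs : IsScale Ω κ δ z w ρ)
include hs

lemma IsScale.bd_lin_pair {E : Type*} [NormedAddCommGroup E] [NormedSpace ℝ E]
    {v : Fin m → E} {n : ℕ} {a : ℝ} (ha : 0 ≤ a) (hv : ∀ j, Bd ρ n a (v j)) :
    Bd ρ (n + 2) (δ * a) (lin v z + lin v w) :=
  (Bd.lin hs.four_le ha hv hs.fst_le).add hs.four_le (Bd.lin hs.four_le ha hv hs.snd_le)

lemma IsScale.bd_two_drift {E : Type*} [NormedAddCommGroup E] [NormedSpace ℝ E]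
    {v : E} {n : ℕ} {a : ℝ} (hv : Bd ρ n a v) :
    Bd ρ (n + 1) (δ ^ 2 * a) ((2 * δ ^ 2) • v) := by
  have h : |δ ^ 2| ≤ δ ^ 2 := by rw [abs_of_nonneg (sq_nonneg δ)]
  rw [two_mul, add_smul]
  exact (hv.smul h).add hs.four_le (hv.smul h)

end Pointwise

/-! ### Moment estimates over one coarse step. -/

section OneStep

variable {W : Type*} [MeasurableSpace W] {ν : Measure W} [IsProbabilityMeasure ν] {κ δ C : ℝ}
  {z w : W → Fin m → ℝ} {ρ : W → ℝ} (hn : IsStepNoise ν Ω κ δ C z w ρ)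
  (hμ : C2Bounds κ μ) (hσ : ∀ j, C2Bounds κ (σ j))
include hn hμ hσ

lemma IsStepNoise.twoStep_growth (x : EuclideanSpace ℝ (Fin d)) :
    ∫ ω, ‖milsteinStep μ σ Ω (δ ^ 2) (milsteinStep μ σ Ω (δ ^ 2) x (z ω)) (w ω)‖ ^ 4 ∂ν
      ≤ ‖x‖ ^ 4 + C * (15 * δ ^ 2 * (‖x‖ ^ 4 + (1 + ‖x‖) ^ 4)) := by
  have hδ := hn.step_pos
  -- `k = 30` is a common ceiling for all exponents of ρ that occur here and in the next estimates;
  -- it requires at most the moment of order 130, below the available 200.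
  have key := integral_norm_add_pow_four_le (ν := ν) (ρ := ρ) (δ := δ) (α := 1 + ‖x‖) (C := C)
    (k := 30)
    (M := fun ω => (lin (fun j => σ j x) (z ω) + lin (fun j => σ j x) (w ω))
      + quad (milsteinCoeff σ x) (pairIncr Ω δ (z ω) (w ω)) + centredRem μ σ Ω δ x (z ω) (w ω))
    (B := fun ω => (2 * δ ^ 2) • μ x + driftRem μ σ Ω δ x (z ω))
    hn.integrable (fun ω => (hn.scale ω).four_le) (fun ω => (hn.scale ω).step_le) hδ
    (by positivity) (hn.moment_le (by norm_num)) ?_ ?_ ?_ x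
  · refine le_of_eq_of_le (integral_congr_ae (.of_forall fun ω => ?_)) key
    simp only
    rw [twoStep_eq]
    congr 2
    abel
  · exact ((hn.meanZero_lin _).add hn.integrable (hn.meanZero_pairIncr _)).add hn.integrable
      (hn.meanZero_centredRem x)
  · intro ω
    have hs := hn.scale ω
    have h4 := hs.four_le
    refine Bd.mono_exp h4 (n := 24) (Bd.add h4 (n := 23) (Bd.add h4 (n := 22) ?_ ?_) ?_)
      (by norm_num)
    · exact (hs.bd_lin_pair (by positivity) fun j => hs.bd_of_growth (hσ j) x).mono_exp h4
        (by norm_num)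
    · exact (hs.drop_step (hs.bd_quad_pairIncr (by positivity) (hs.bd_milsteinCoeff hσ x))
        (by positivity) (le_of_eq (by ring))).mono_exp h4 (by norm_num)
    · exact (hs.drop_step (hs.bd_centredRem_crude hμ hσ x)
        (by positivity) (le_of_eq (by ring))).mono_exp h4 (by norm_num)
  · intro ω
    have hs := hn.scale ω
    have h4 := hs.four_le
    refine Bd.mono_exp h4 (n := 20) (Bd.add h4 (n := 19) ?_ ?_) (by norm_num)
    · exact (hs.bd_two_drift (hs.bd_of_growth hμ x)).mono_exp h4 (by norm_num)
    · exact hs.drop_step (hs.bd_driftRem_crude hμ hσ x) (by positivity) (le_of_eq (by ring))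

lemma IsStepNoise.coarseStep_growth (x : EuclideanSpace ℝ (Fin d)) :
    ∫ ω, ‖milsteinStep μ σ Ω (2 * δ ^ 2) x (z ω + w ω)‖ ^ 4 ∂ν
      ≤ ‖x‖ ^ 4 + C * (15 * δ ^ 2 * (‖x‖ ^ 4 + (1 + ‖x‖) ^ 4)) := by
  have hδ := hn.step_pos
  have key := integral_norm_add_pow_four_le (ν := ν) (ρ := ρ) (δ := δ) (α := 1 + ‖x‖) (C := C)
    (k := 30)
    (M := fun ω => (lin (fun j => σ j x) (z ω) + lin (fun j => σ j x) (w ω))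
      + ((1 / 2 : ℝ) • quad (milsteinCoeff σ x) (pairIncr Ω δ (z ω) (w ω))
        + (1 / 2 : ℝ) • quad (milsteinCoeff σ x) (pairIncr Ω δ (w ω) (z ω))))
    (B := fun ω => (2 * δ ^ 2) • μ x)
    hn.integrable (fun ω => (hn.scale ω).four_le) (fun ω => (hn.scale ω).step_le) hδ
    (by positivity) (hn.moment_le (by norm_num)) ?_ ?_ ?_ x
  · refine le_of_eq_of_le (integral_congr_ae (.of_forall fun ω => ?_)) key
    simp only
    rw [coarseStep_eq]
    congr 2
    abel
  · exact (hn.meanZero_lin _).add hn.integrable (((hn.meanZero_pairIncr _).smul _).add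
      hn.integrable ((hn.swap.meanZero_pairIncr _).smul _))
  · intro ω
    have hs := hn.scale ω
    have h4 := hs.four_le
    have ht : |(1 / 2 : ℝ)| ≤ 1 := by norm_num [abs_of_pos]
    refine Bd.mono_exp h4 (n := 24) (Bd.add h4 (n := 23) ?_ (Bd.add h4 (n := 22) ?_ ?_))
      (by norm_num)
    · exact (hs.bd_lin_pair (by positivity) fun j => hs.bd_of_growth (hσ j) x).mono_exp h4
        (by norm_num)
    · exact ((hs.drop_step (hs.bd_quad_pairIncr (by positivity) (hs.bd_milsteinCoeff hσ x))
        (by positivity) (le_of_eq (by ring))).mono_exp h4 (by norm_num)).smul_of_le_one ht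
    · exact ((hs.drop_step (hs.swap.bd_quad_pairIncr (by positivity) (hs.bd_milsteinCoeff hσ x))
        (by positivity) (le_of_eq (by ring))).mono_exp h4 (by norm_num)).smul_of_le_one ht
  · intro ω
    have hs := hn.scale ω
    exact (hs.bd_two_drift (hs.bd_of_growth hμ x)).mono_exp hs.four_le (by norm_num)

/-- No cancellation between the quadratic noise terms is sought: each is bounded separately by δ ·
δ(1 + ‖·‖), which costs the term δ(…) in the error and limits the strong order to δ. -/
lemma IsStepNoise.strong_difference (x y : EuclideanSpace ℝ (Fin d)) :
    ∫ ω, ‖milsteinStep μ σ Ω (δ ^ 2) (milsteinStep μ σ Ω (δ ^ 2) x (z ω)) (w ω)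
        - milsteinStep μ σ Ω (2 * δ ^ 2) y (z ω + w ω)‖ ^ 4 ∂ν
      ≤ ‖x - y‖ ^ 4 + C * (15 * δ ^ 2 * (‖x - y‖ ^ 4
        + (‖x - y‖ + δ * (1 + ‖x‖ + (1 + ‖y‖))) ^ 4)) := by
  have hδ := hn.step_pos
  set α := ‖x - y‖ + δ * (1 + ‖x‖ + (1 + ‖y‖)) with hα
  have hα0 : 0 ≤ α := by positivity
  have ha1 : ‖x - y‖ ≤ α := le_add_of_nonneg_right (by positivity)
  have ha2 : δ * (1 + ‖x‖) ≤ α := by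
    rw [hα]; nlinarith [norm_nonneg (x - y), mul_nonneg hδ.le (norm_nonneg y)]
  have ha3 : δ * (1 + ‖y‖) ≤ α := by
    rw [hα]; nlinarith [norm_nonneg (x - y), mul_nonneg hδ.le (norm_nonneg x)]
  have ha2' : δ ^ 2 * (1 + ‖x‖) ≤ δ * α := by
    rw [pow_two, mul_assoc]; gcongr
  have ha3' : δ ^ 2 * (1 + ‖y‖) ≤ δ * α := by
    rw [pow_two, mul_assoc]; gcongr
  have key := integral_norm_add_pow_four_le (ν := ν) (ρ := ρ) (δ := δ) (α := α) (C := C)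
    (k := 30)
    (M := fun ω => (lin (fun j => σ j x - σ j y) (z ω) + lin (fun j => σ j x - σ j y) (w ω))
      + (quad (milsteinCoeff σ x) (pairIncr Ω δ (z ω) (w ω))
        - ((1 / 2 : ℝ) • quad (milsteinCoeff σ y) (pairIncr Ω δ (z ω) (w ω))
          + (1 / 2 : ℝ) • quad (milsteinCoeff σ y) (pairIncr Ω δ (w ω) (z ω))))
      + centredRem μ σ Ω δ x (z ω) (w ω))
    (B := fun ω => (2 * δ ^ 2) • (μ x - μ y) + driftRem μ σ Ω δ x (z ω))
    hn.integrable (fun ω => (hn.scale ω).four_le) (fun ω => (hn.scale ω).step_le) hδ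
    hα0 (hn.moment_le (by norm_num)) ?_ ?_ ?_ (x - y)
  · refine le_of_eq_of_le (integral_congr_ae (.of_forall fun ω => ?_)) key
    simp only
    rw [twoStep_eq, coarseStep_eq, lin_sub_left, lin_sub_left, smul_sub]
    congr 2
    abel
  · exact ((hn.meanZero_lin _).add hn.integrable ((hn.meanZero_pairIncr _).sub hn.integrable
      (((hn.meanZero_pairIncr _).smul _).add hn.integrable
        ((hn.swap.meanZero_pairIncr _).smul _)))).add hn.integrable (hn.meanZero_centredRem x)
  · intro ω
    have hs := hn.scale ω
    have h4 := hs.four_le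
    have ht : |(1 / 2 : ℝ)| ≤ 1 := by norm_num [abs_of_pos]
    refine Bd.mono_exp h4 (n := 26) (Bd.add h4 (n := 25) (Bd.add h4 (n := 24) ?_
      (Bd.sub h4 (n := 23) ?_ (Bd.add h4 (n := 22) ?_ ?_))) ?_) (by norm_num)
    · exact (hs.bd_lin_pair hα0 fun j => (hs.bd_of_lip (hσ j) x y).mono h4 ha1).mono_exp h4
        (by norm_num)
    · exact ((hs.bd_quad_pairIncr (by positivity) (hs.bd_milsteinCoeff hσ x)).mono h4
        ha2').mono_exp h4 (by norm_num)
    · exact (((hs.bd_quad_pairIncr (by positivity) (hs.bd_milsteinCoeff hσ y)).mono h4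
        ha3').mono_exp h4 (by norm_num)).smul_of_le_one ht
    · exact (((hs.swap.bd_quad_pairIncr (by positivity) (hs.bd_milsteinCoeff hσ y)).mono h4
        ha3').mono_exp h4 (by norm_num)).smul_of_le_one ht
    · exact ((hs.bd_centredRem_crude hμ hσ x).mono h4 ha2').mono_exp h4 (by norm_num)
  · intro ω
    have hs := hn.scale ω
    have h4 := hs.four_le
    refine Bd.mono_exp h4 (n := 20) (Bd.add h4 (n := 19) ?_ ?_) (by norm_num)
    · exact (hs.bd_two_drift ((hs.bd_of_lip hμ x y).mono h4 ha1)).mono_exp h4 (by norm_num)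
    · refine ((hs.bd_driftRem_crude hμ hσ x).mono h4 ?_).mono_exp h4 (by norm_num)
      calc δ ^ 3 * (1 + ‖x‖) = δ ^ 2 * (δ * (1 + ‖x‖)) := by ring
        _ ≤ _ := by gcongr

/-- The coarse noise is split between the two orders, so every `pairIncr` meets a difference of
coefficients, at x and y or at x' and y. The linear terms reduce to the midpoint by
`IsScale.bd_average`. The centred part then has size δβ and the rest δ²β. -/
lemma IsStepNoise.antithetic_difference (x x' y : EuclideanSpace ℝ (Fin d)) :
    ∫ ω, ‖(1 / 2 : ℝ) • (milsteinStep μ σ Ω (δ ^ 2) (milsteinStep μ σ Ω (δ ^ 2) x (z ω)) (w ω)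
        + milsteinStep μ σ Ω (δ ^ 2) (milsteinStep μ σ Ω (δ ^ 2) x' (w ω)) (z ω))
        - milsteinStep μ σ Ω (2 * δ ^ 2) y (z ω + w ω)‖ ^ 2 ∂ν
      ≤ ‖(1 / 2 : ℝ) • (x + x') - y‖ ^ 2 + C * (2 * δ ^ 2 * (‖(1 / 2 : ℝ) • (x + x') - y‖ ^ 2
        + (‖(1 / 2 : ℝ) • (x + x') - y‖ + ‖x - y‖ ^ 2 + ‖x' - y‖ ^ 2
          + δ ^ 2 * ((1 + ‖x‖) ^ 2 + (1 + ‖x'‖) ^ 2 + (1 + ‖y‖) ^ 2)) ^ 2)) := by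
  have hδ := hn.step_pos
  set e := (1 / 2 : ℝ) • (x + x') - y with he
  set β := ‖e‖ + ‖x - y‖ ^ 2 + ‖x' - y‖ ^ 2
    + δ ^ 2 * ((1 + ‖x‖) ^ 2 + (1 + ‖x'‖) ^ 2 + (1 + ‖y‖) ^ 2) with hβ
  have p1 : 0 ≤ δ ^ 2 * (1 + ‖x‖) ^ 2 := by positivity
  have p2 : 0 ≤ δ ^ 2 * (1 + ‖x'‖) ^ 2 := by positivity
  have p3 : 0 ≤ δ ^ 2 * (1 + ‖y‖) ^ 2 := by positivity
  have p4 : 0 ≤ ‖x - y‖ ^ 2 := by positivity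
  have p5 : 0 ≤ ‖x' - y‖ ^ 2 := by positivity
  have p6 : 0 ≤ ‖e‖ := by positivity
  have hβ0 : 0 ≤ β := by positivity
  have b1 : ‖e‖ ≤ β := by linarith
  have b2 : ‖x - y‖ ^ 2 ≤ β := by linarith
  have b3 : ‖x' - y‖ ^ 2 ≤ β := by linarith
  have b4 : δ ^ 2 * (1 + ‖x‖) ^ 2 ≤ β := by linarith
  have b5 : δ ^ 2 * (1 + ‖x'‖) ^ 2 ≤ β := by linarith
  -- Young's inequality: δ‖x − y‖(1 + ‖y‖) is dominated by ‖x − y‖² + δ²(1 + ‖y‖)², both contained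
  -- in β.
  have b6 : δ ^ 2 * (‖x - y‖ * (1 + ‖y‖)) ≤ δ * β := by
    have : δ * (‖x - y‖ * (1 + ‖y‖)) ≤ β := by
      nlinarith [sq_nonneg (‖x - y‖ - δ * (1 + ‖y‖))]
    rw [pow_two, mul_assoc]; gcongr
  have b7 : δ ^ 2 * (‖x' - y‖ * (1 + ‖y‖)) ≤ δ * β := by
    have : δ * (‖x' - y‖ * (1 + ‖y‖)) ≤ β := by
      nlinarith [sq_nonneg (‖x' - y‖ - δ * (1 + ‖y‖))]
    rw [pow_two, mul_assoc]; gcongr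
  have b8 : δ ^ 3 * (1 + ‖x‖) ^ 2 ≤ δ * β := by
    calc _ = δ * (δ ^ 2 * (1 + ‖x‖) ^ 2) := by ring
      _ ≤ _ := by gcongr
  have b9 : δ ^ 3 * (1 + ‖x'‖) ^ 2 ≤ δ * β := by
    calc _ = δ * (δ ^ 2 * (1 + ‖x'‖) ^ 2) := by ring
      _ ≤ _ := by gcongr
  have b10 : δ ^ 4 * (1 + ‖x‖) ^ 2 ≤ δ ^ 2 * β := by
    calc _ = δ ^ 2 * (δ ^ 2 * (1 + ‖x‖) ^ 2) := by ring
      _ ≤ _ := by gcongr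
  have b11 : δ ^ 4 * (1 + ‖x'‖) ^ 2 ≤ δ ^ 2 * β := by
    calc _ = δ ^ 2 * (δ ^ 2 * (1 + ‖x'‖) ^ 2) := by ring
      _ ≤ _ := by gcongr
  have ht : |(1 / 2 : ℝ)| ≤ 1 := by norm_num [abs_of_pos]
  let V : Fin m → EuclideanSpace ℝ (Fin d) :=
    fun j => (1 / 2 : ℝ) • σ j x + (1 / 2 : ℝ) • σ j x' - σ j y
  have hV : ∀ u : Fin m → ℝ, lin V u = (1 / 2 : ℝ) • lin (fun j => σ j x) u
      + (1 / 2 : ℝ) • lin (fun j => σ j x') u - lin (fun j => σ j y) u := by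
    intro u
    simp only [V, lin, Finset.smul_sum, ← Finset.sum_add_distrib, ← Finset.sum_sub_distrib]
    exact Finset.sum_congr rfl fun j _ => by module
  have key := integral_norm_add_sq_le (ν := ν) (ρ := ρ) (δ := δ) (α := β) (C := C)
    (k := 30)
    (M := fun ω => (lin V (z ω) + lin V (w ω))
      + ((1 / 2 : ℝ) • quad (fun j k => milsteinCoeff σ x j k - milsteinCoeff σ y j k)
          (pairIncr Ω δ (z ω) (w ω))
        + (1 / 2 : ℝ) • quad (fun j k => milsteinCoeff σ x' j k - milsteinCoeff σ y j k)
          (pairIncr Ω δ (w ω) (z ω)))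
      + ((1 / 2 : ℝ) • centredRem μ σ Ω δ x (z ω) (w ω)
        + (1 / 2 : ℝ) • centredRem μ σ Ω δ x' (w ω) (z ω)))
    (B := fun ω => (2 * δ ^ 2) • ((1 / 2 : ℝ) • μ x + (1 / 2 : ℝ) • μ x' - μ y)
      + ((1 / 2 : ℝ) • driftRem μ σ Ω δ x (z ω) + (1 / 2 : ℝ) • driftRem μ σ Ω δ x' (w ω)))
    hn.integrable (fun ω => (hn.scale ω).four_le) (fun ω => (hn.scale ω).step_le) hδ
    hβ0 (hn.moment_le (by norm_num)) ?_ ?_ ?_ e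
  · refine le_of_eq_of_le (integral_congr_ae (.of_forall fun ω => ?_)) key
    simp only
    rw [twoStep_eq, twoStep_eq, coarseStep_eq, hV, hV, quad_sub_left, quad_sub_left, he]
    congr 2
    module
  · exact ((hn.meanZero_lin V).add hn.integrable
      (((hn.meanZero_pairIncr _).smul _).add hn.integrable
        ((hn.swap.meanZero_pairIncr _).smul _))).add hn.integrable
      (((hn.meanZero_centredRem x).smul _).add hn.integrable
        ((hn.swap.meanZero_centredRem x').smul _))
  · intro ω
    have hs := hn.scale ω
    have h4 := hs.four_le
    refine Bd.mono_exp h4 (n := 26) (Bd.add h4 (n := 25) (Bd.add h4 (n := 24) ?_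
      (Bd.add h4 (n := 23) ?_ ?_)) (Bd.add h4 (n := 24) ?_ ?_)) (by norm_num)
    · exact (hs.bd_lin_pair hβ0 fun j => hs.bd_average (hσ j) x x' y b1 b2 b3).mono_exp h4
        (by norm_num)
    · exact (((hs.bd_quad_pairIncr (by positivity) (hs.bd_milsteinCoeff_sub hσ x y)).mono h4
        b6).mono_exp h4 (by norm_num)).smul_of_le_one ht
    · exact (((hs.swap.bd_quad_pairIncr (by positivity) (hs.bd_milsteinCoeff_sub hσ x' y)).mono h4
        b7).mono_exp h4 (by norm_num)).smul_of_le_one ht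
    · exact (((hs.bd_centredRem hμ hσ x).mono h4 b8).mono_exp h4 (by norm_num)).smul_of_le_one ht
    · exact (((hs.swap.bd_centredRem hμ hσ x').mono h4 b9).mono_exp h4
        (by norm_num)).smul_of_le_one ht
  · intro ω
    have hs := hn.scale ω
    have h4 := hs.four_le
    refine Bd.mono_exp h4 (n := 20) (Bd.add h4 (n := 19) ?_ (Bd.add h4 (n := 18) ?_ ?_))
      (by norm_num)
    · exact (hs.bd_two_drift (hs.bd_average hμ x x' y b1 b2 b3)).mono_exp h4 (by norm_num)
    · exact ((hs.bd_driftRem hμ hσ x).mono h4 b10).smul_of_le_one ht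
    · exact ((hs.swap.bd_driftRem hμ hσ x').mono h4 b11).smul_of_le_one ht

end OneStep

/-! ### The Lyapunov function and its one-step growth. -/

/-- The Lyapunov function of the coupled fine, antithetic and coarse paths. -/
def lyapunov (δ : ℝ) (s : EuclideanSpace ℝ (Fin d) × EuclideanSpace ℝ (Fin d) ×
    EuclideanSpace ℝ (Fin d)) : ℝ :=
  ‖(1 / 2 : ℝ) • (s.1 + s.2.1) - s.2.2‖ ^ 2 + (‖s.1 - s.2.2‖ ^ 4 + ‖s.2.1 - s.2.2‖ ^ 4)
    + δ ^ 4 * (3 + ‖s.1‖ ^ 4 + ‖s.2.1‖ ^ 4 + ‖s.2.2‖ ^ 4)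

/-- One coarse step of the coupled paths, with fine increments `z` and `w`. -/
def coupledStep (μ : EuclideanSpace ℝ (Fin d) → EuclideanSpace ℝ (Fin d))
    (σ : Fin m → EuclideanSpace ℝ (Fin d) → EuclideanSpace ℝ (Fin d))
    (Ω : Matrix (Fin m) (Fin m) ℝ) (δ : ℝ)
    (s : EuclideanSpace ℝ (Fin d) × EuclideanSpace ℝ (Fin d) × EuclideanSpace ℝ (Fin d))
    (z w : Fin m → ℝ) :
    EuclideanSpace ℝ (Fin d) × EuclideanSpace ℝ (Fin d) × EuclideanSpace ℝ (Fin d) :=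
  (milsteinStep μ σ Ω (δ ^ 2) (milsteinStep μ σ Ω (δ ^ 2) s.1 z) w,
    milsteinStep μ σ Ω (δ ^ 2) (milsteinStep μ σ Ω (δ ^ 2) s.2.1 w) z,
    milsteinStep μ σ Ω (2 * δ ^ 2) s.2.2 (z + w))

lemma lyapunov_nonneg (δ : ℝ) (s : EuclideanSpace ℝ (Fin d) × EuclideanSpace ℝ (Fin d) ×
    EuclideanSpace ℝ (Fin d)) : 0 ≤ lyapunov δ s := by
  unfold lyapunov; positivity

lemma add_pow_four_le (a b : ℝ) : (a + b) ^ 4 ≤ 8 * (a ^ 4 + b ^ 4) := by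
  have h1 : (a + b) ^ 2 ≤ 2 * (a ^ 2 + b ^ 2) := add_sq_le
  have h2 : (a ^ 2 + b ^ 2) ^ 2 ≤ 2 * ((a ^ 2) ^ 2 + (b ^ 2) ^ 2) := add_sq_le
  have h3 : ((a + b) ^ 2) ^ 2 ≤ (2 * (a ^ 2 + b ^ 2)) ^ 2 := by gcongr
  nlinarith

lemma one_add_pow_four_le (t : ℝ) : (1 + t) ^ 4 ≤ 8 * (1 + t ^ 4) := by
  simpa using add_pow_four_le 1 t

lemma growth_bound {D V t : ℝ} (hD : 0 ≤ D) (ht : D * (1 + t ^ 4) ≤ V) :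
    D * (t ^ 4 + (1 + t) ^ 4) ≤ 10 * V := by
  calc D * (t ^ 4 + (1 + t) ^ 4) ≤ D * (t ^ 4 + 8 * (1 + t ^ 4)) := by
        gcongr; exact one_add_pow_four_le t
    _ ≤ D * (10 * (1 + t ^ 4)) := by
        have : 0 ≤ t ^ 4 := by positivity
        gcongr; linarith
    _ ≤ 10 * V := by linarith

/-- Convexity of the fourth power gives the factors 9 on t⁴ and 512 = 8 · 64 on the weighted part;
600 is a rounded maximum. -/
lemma strong_bound {δ V t u c : ℝ} (h : δ ^ 4 * (2 + u ^ 4 + c ^ 4) + t ^ 4 ≤ V) :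
    t ^ 4 + (t + δ * (1 + u + (1 + c))) ^ 4 ≤ 600 * V := by
  have h1 := add_pow_four_le t (δ * (1 + u + (1 + c)))
  have h2 := add_pow_four_le (1 + u) (1 + c)
  rw [mul_pow] at h1
  have h4 : δ ^ 4 * (1 + u + (1 + c)) ^ 4 ≤ δ ^ 4 * (64 * (2 + u ^ 4 + c ^ 4)) := by
    gcongr
    have := one_add_pow_four_le u
    have := one_add_pow_four_le c
    generalize (1 + u) ^ 4 = U at *
    generalize (1 + c) ^ 4 = K at *
    generalize (1 + u + (1 + c)) ^ 4 = L at *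
    linarith
  have h5 : 0 ≤ δ ^ 4 * (2 + u ^ 4 + c ^ 4) := by positivity
  have h6 : 0 ≤ t ^ 4 := by positivity
  generalize δ ^ 4 * (1 + u + (1 + c)) ^ 4 = U at *
  generalize (t + δ * (1 + u + (1 + c))) ^ 4 = L at *
  linarith

lemma antithetic_bound {δ V e p q a b c : ℝ}
    (h : e ^ 2 + (p ^ 4 + q ^ 4) + δ ^ 4 * (3 + a ^ 4 + b ^ 4 + c ^ 4) ≤ V) :
    e ^ 2 + (e + p ^ 2 + q ^ 2 + δ ^ 2 * ((1 + a) ^ 2 + (1 + b) ^ 2 + (1 + c) ^ 2)) ^ 2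
      ≤ 200 * V := by
  have h1 : ((1 + a) ^ 2 + (1 + b) ^ 2 + (1 + c) ^ 2) ^ 2 ≤ 24 * (3 + a ^ 4 + b ^ 4 + c ^ 4) := by
    have ha := one_add_pow_four_le a
    have hb := one_add_pow_four_le b
    have hc := one_add_pow_four_le c
    have e4 : ∀ t : ℝ, (1 + t) ^ 4 = ((1 + t) ^ 2) ^ 2 := fun t => by ring
    rw [e4] at ha hb hc
    generalize (1 + a) ^ 2 = A at *
    generalize (1 + b) ^ 2 = B at *
    generalize (1 + c) ^ 2 = K at *
    nlinarith [sq_nonneg (A - B), sq_nonneg (A - K), sq_nonneg (B - K)]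
  generalize (1 + a) ^ 2 + (1 + b) ^ 2 + (1 + c) ^ 2 = k at *
  have h2 : δ ^ 4 * k ^ 2 ≤ δ ^ 4 * (24 * (3 + a ^ 4 + b ^ 4 + c ^ 4)) := by gcongr
  have i1 : (e + p ^ 2 + (q ^ 2 + δ ^ 2 * k)) ^ 2 ≤
    2 * ((e + p ^ 2) ^ 2 + (q ^ 2 + δ ^ 2 * k) ^ 2) := add_sq_le
  have i2 : (e + p ^ 2) ^ 2 ≤ 2 * (e ^ 2 + (p ^ 2) ^ 2) := add_sq_le
  have i3 : (q ^ 2 + δ ^ 2 * k) ^ 2 ≤ 2 * ((q ^ 2) ^ 2 + (δ ^ 2 * k) ^ 2) := add_sq_le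
  have i4 : (δ ^ 2 * k) ^ 2 = δ ^ 4 * k ^ 2 := by rw [mul_pow, ← pow_mul]
  have i6 : (p ^ 2) ^ 2 = p ^ 4 := by ring
  have i7 : (q ^ 2) ^ 2 = q ^ 4 := by ring
  rw [← add_assoc] at i1
  rw [i4, i7] at i3
  rw [i6] at i2
  have p1 : 0 ≤ e ^ 2 := by positivity
  have p2 : 0 ≤ p ^ 4 := by positivity
  have p3 : 0 ≤ q ^ 4 := by positivity
  have p4 : 0 ≤ δ ^ 4 * (3 + a ^ 4 + b ^ 4 + c ^ 4) := by positivity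
  generalize (e + p ^ 2 + q ^ 2 + δ ^ 2 * k) ^ 2 = L at *
  generalize (e + p ^ 2) ^ 2 = L1 at *
  generalize (q ^ 2 + δ ^ 2 * k) ^ 2 = L2 at *
  linarith

/-- The error terms left by the one-step estimates are controlled by the pieces of the Lyapunov
function itself, so the system of inequalities closes. -/
theorem IsStepNoise.integral_lyapunov_le {W : Type*} [MeasurableSpace W] {ν : Measure W}
    [IsProbabilityMeasure ν] {κ δ C : ℝ} {z w : W → Fin m → ℝ} {ρ : W → ℝ}
    (hn : IsStepNoise ν Ω κ δ C z w ρ) (hμ : C2Bounds κ μ) (hσ : ∀ j, C2Bounds κ (σ j))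
    (s : EuclideanSpace ℝ (Fin d) × EuclideanSpace ℝ (Fin d) × EuclideanSpace ℝ (Fin d)) :
    ∫ ω, lyapunov δ (coupledStep μ σ Ω δ s (z ω) (w ω)) ∂ν
      ≤ (1 + 20000 * C * δ ^ 2) * lyapunov δ s := by
  obtain ⟨x, x', y⟩ := s
  have hC := hn.const_nonneg
  have hi := hn.integrable
  have g1 := hn.twoStep_growth hμ hσ x
  have g2 := hn.swap.twoStep_growth hμ hσ x'
  have g3 := hn.coarseStep_growth hμ hσ y
  have g4 := hn.strong_difference hμ hσ x y
  have g5 := hn.swap.strong_difference hμ hσ x' y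
  have g6 := hn.antithetic_difference hμ hσ x x' y
  -- Exchanging the roles of the increments handles the antithetic path; the coarse increment is
  -- symmetric in them.
  simp only [add_comm (w _) (z _)] at g5
  have c0 : ∫ _ : W, (3 : ℝ) ∂ν = 3 := by simp
  have hV : lyapunov δ (x, x', y) = ‖(1 / 2 : ℝ) • (x + x') - y‖ ^ 2
    + (‖x - y‖ ^ 4 + ‖x' - y‖ ^ 4) + δ ^ 4 * (3 + ‖x‖ ^ 4 + ‖x'‖ ^ 4 + ‖y‖ ^ 4) := rfl
  have hD : 0 ≤ δ ^ 4 := by positivity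
  have q1 : 0 ≤ ‖(1 / 2 : ℝ) • (x + x') - y‖ ^ 2 := by positivity
  have q2 : 0 ≤ ‖x - y‖ ^ 4 := by positivity
  have q3 : 0 ≤ ‖x' - y‖ ^ 4 := by positivity
  have q4 : 0 ≤ δ ^ 4 * ‖x‖ ^ 4 := by positivity
  have q5 : 0 ≤ δ ^ 4 * ‖x'‖ ^ 4 := by positivity
  have q6 : 0 ≤ δ ^ 4 * ‖y‖ ^ 4 := by positivity
  have hV0 := lyapunov_nonneg δ (x, x', y)
  generalize lyapunov δ (x, x', y) = V at *
  simp only [lyapunov, coupledStep]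
  rw [integral_add (hi _) (hi _), integral_add (hi _) (hi _), integral_add (hi _) (hi _),
    integral_const_mul, integral_add (hi _) (hi _), integral_add (hi _) (hi _),
    integral_add (hi _) (hi _), c0]
  have r1 := growth_bound (D := δ ^ 4) (V := V) (t := ‖x‖) hD (by linarith)
  have r2 := growth_bound (D := δ ^ 4) (V := V) (t := ‖x'‖) hD (by linarith)
  have r3 := growth_bound (D := δ ^ 4) (V := V) (t := ‖y‖) hD (by linarith)
  have r4 := strong_bound (δ := δ) (V := V) (t := ‖x - y‖) (u := ‖x‖) (c := ‖y‖) (by linarith)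
  have r5 := strong_bound (δ := δ) (V := V) (t := ‖x' - y‖) (u := ‖x'‖) (c := ‖y‖) (by linarith)
  have r6 := antithetic_bound hV.ge
  have lift : ∀ {I X Y N : ℝ} (n : ℝ), I ≤ X + C * (n * δ ^ 2 * Y) → 0 ≤ n → Y ≤ N →
      I ≤ X + n * (C * δ ^ 2 * N) := fun {I X Y N} n h hn hY => by
    calc I ≤ _ := h
      _ = X + n * (C * δ ^ 2 * Y) := by ring
      _ ≤ _ := by gcongr
  have lift' : ∀ {I X Y : ℝ}, I ≤ X + C * (15 * δ ^ 2 * Y) → δ ^ 4 * Y ≤ 10 * V →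
      δ ^ 4 * I ≤ δ ^ 4 * X + 15 * (C * δ ^ 2 * (10 * V)) := fun {I X Y} h hY => by
    calc δ ^ 4 * I ≤ δ ^ 4 * (X + C * (15 * δ ^ 2 * Y)) := by gcongr
      _ = δ ^ 4 * X + 15 * (C * δ ^ 2 * (δ ^ 4 * Y)) := by ring
      _ ≤ _ := by gcongr
  have s1 := lift' g1 r1
  have s2 := lift' g2 r2
  have s3 := lift' g3 r3
  have s4 := lift 15 g4 (by norm_num) r4
  have s5 := lift 15 g5 (by norm_num) r5
  have s6 := lift 2 g6 (by norm_num) r6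
  have hCV : 0 ≤ C * δ ^ 2 * V := by positivity
  clear g1 g2 g3 g4 g5 g6 r1 r2 r3 r4 r5 r6 lift lift'
  rw [mul_add, mul_add, mul_add]
  rw [mul_add, mul_add, mul_add] at hV
  have hf : (1 + 20000 * C * δ ^ 2) * V = V + 20000 * (C * δ ^ 2 * V) := by ring
  rw [hf]
  -- The growth terms add up to 3 · 15 · 10 + 2 · 15 · 600 + 2 · 200 = 18850, below 20000.
  linarith

end Milstein

lemma stepSize_pos {T : ℝ} (hT : 0 < T) (l : ℕ) : 0 < stepSize T l := by
  unfold stepSize; positivity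

lemma stepSize_le {T : ℝ} (hT : 0 < T) (l : ℕ) : stepSize T l ≤ T :=
  div_le_self hT.le (one_le_pow₀ (by norm_num))

lemma stepSize_eq_pow_mul {T : ℝ} {L l : ℕ} (h : l ≤ L) :
    stepSize T l = 2 ^ (L - l) * stepSize T L := by
  unfold stepSize
  obtain ⟨k, rfl⟩ := Nat.exists_eq_add_of_le h
  rw [Nat.add_sub_cancel_left, pow_add]
  field_simp

/-! ### Moments of the binomial increments. -/

section Law

lemma ae_binomial_le (n : ℕ) (p : unitInterval) : ∀ᵐ k ∂binomial n p, k ≤ n :=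
  ae_le_of_hasLaw_binomial (X := id) ⟨aemeasurable_id, Measure.map_id⟩

lemma weakIncrementLaw_finite_support (T : ℝ) (L l : ℕ) :
    ∃ F : Set ℝ, F.Finite ∧ ∀ᵐ x ∂weakIncrementLaw T L l, x ∈ F := by
  refine ⟨(fun k : ℕ => ((k : ℝ) - 2 ^ (L - l) / 2) * (2 * √(stepSize T L))) ''
    Set.Iic (2 ^ (L - l)), (Set.finite_Iic _).image _, ?_⟩
  unfold weakIncrementLaw
  refine (ae_map_iff (p := fun x => x ∈ _ '' _) Measurable.of_discrete.aemeasurable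
    ((Set.finite_Iic _).image _).measurableSet).2 ?_
  filter_upwards [ae_binomial_le (2 ^ (L - l)) _] with k hk
  exact ⟨k, hk, rfl⟩

lemma integral_weakIncrementLaw (T : ℝ) (L l : ℕ) {g : ℝ → ℝ} (hg : Continuous g) :
    ∫ x, g x ∂weakIncrementLaw T L l = ∑ k ∈ Finset.range (2 ^ (L - l) + 1),
      ((2 ^ (L - l)).choose k * (1 / 2 : ℝ) ^ k * (1 / 2) ^ (2 ^ (L - l) - k))
        * g (((k : ℝ) - 2 ^ (L - l) / 2) * (2 * √(stepSize T L))) := by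
  rw [weakIncrementLaw, integral_map Measurable.of_discrete.aemeasurable
    hg.aestronglyMeasurable, integral_binomial]
  have : Finset.Iic (2 ^ (L - l)) = Finset.range (2 ^ (L - l) + 1) := by
    ext; simp
  rw [this]
  refine Finset.sum_congr rfl fun k _ => ?_
  norm_num

/-- The reflection k ↦ n − k preserves the weights and changes the sign of the value. -/
lemma integral_id_weakIncrementLaw (T : ℝ) (L l : ℕ) :
    ∫ x, x ∂weakIncrementLaw T L l = 0 := by
  rw [integral_weakIncrementLaw T L l (g := fun x => x) continuous_id]
  set n := 2 ^ (L - l) with hn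
  set s := ∑ k ∈ Finset.range (n + 1), ((n.choose k * (1 / 2 : ℝ) ^ k * (1 / 2) ^ (n - k))
        * (((k : ℝ) - 2 ^ (L - l) / 2) * (2 * √(stepSize T L)))) with hs
  have hflip : s = -s := by
    rw [hs]
    nth_rewrite 1 [← Finset.sum_flip]
    rw [← Finset.sum_neg_distrib]
    refine Finset.sum_congr rfl fun k hk => ?_
    have hk' : k ≤ n := Nat.lt_succ_iff.mp (Finset.mem_range.mp hk)
    rw [Nat.choose_symm hk', Nat.sub_sub_self hk', Nat.cast_sub hk']
    have : (n : ℝ) = 2 ^ (L - l) := by rw [hn]; push_cast; rfl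
    rw [this]
    ring
  linarith

/-- The binomial theorem for (e^c/2 + e^(-c)/2)^n: the increment has the law of a sum of n = 2^(L-l)
independent signs times √Δ_L. -/
lemma integral_exp_weakIncrementLaw (T : ℝ) (L l : ℕ) (t : ℝ) :
    ∫ x, Real.exp (t * x) ∂weakIncrementLaw T L l
      = Real.cosh (t * √(stepSize T L)) ^ 2 ^ (L - l) := by
  rw [integral_weakIncrementLaw T L l (g := fun x => Real.exp (t * x)) (by fun_prop)]
  set n := 2 ^ (L - l) with hn
  set c := t * √(stepSize T L) with hc
  have h2 : (2 : ℝ) ^ (L - l) = n := by rw [hn]; push_cast; rfl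
  rw [Real.cosh_eq, show (Real.exp c + Real.exp (-c)) / 2
    = 1 / 2 * Real.exp c + 1 / 2 * Real.exp (-c) by ring, add_pow]
  refine Finset.sum_congr rfl fun k hk => ?_
  have hk' : k ≤ n := Nat.lt_succ_iff.mp (Finset.mem_range.mp hk)
  rw [mul_pow, mul_pow, ← Real.exp_nat_mul, ← Real.exp_nat_mul, h2, Nat.cast_sub hk']
  have : Real.exp (t * (((k : ℝ) - n / 2) * (2 * √(stepSize T L))))
      = Real.exp (k * c) * Real.exp ((n - k) * -c) := by
    rw [← Real.exp_add, hc]; congr 1; ring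
  rw [this]; ring

/-- No measurability of `g` is needed, which is what allows `IsStepNoise` to demand integrability of
every function. -/
lemma integrable_of_finite_support {X : Type*} [MeasurableSpace X] [MeasurableSingletonClass X]
    {ν : Measure X} [IsFiniteMeasure ν] {F : Set X} (hF : F.Finite) (h : ∀ᵐ x ∂ν, x ∈ F)
    {E : Type*} [NormedAddCommGroup E] (g : X → E) : Integrable g ν := by
  have : ν.restrict F = ν := Measure.restrict_eq_self_of_ae_mem h
  rw [← this]
  exact IntegrableOn.of_finite hF

instance (T : ℝ) (L l : ℕ) : IsProbabilityMeasure (weakIncrementLaw T L l) :=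
  Measure.isProbabilityMeasure_map Measurable.of_discrete.aemeasurable

/-- Since cosh c ≤ exp(c²/2), the 2^(L-l) factors multiply to exp(2^(L-l) Δ_L / (2 Δ_l)), and
2^(L-l) Δ_L = Δ_l. This is where dependence on L and l disappears. -/
lemma integral_exp_normalized_le {T : ℝ} (hT : 0 < T) {L l : ℕ} (h : l ≤ L) {ε : ℝ}
    (hε : ε ^ 2 = 1) :
    ∫ x, Real.exp (ε / √(stepSize T l) * x) ∂weakIncrementLaw T L l ≤ Real.exp (1 / 2) := by
  have h0 := stepSize_pos hT L
  have h1 := stepSize_pos hT l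
  rw [integral_exp_weakIncrementLaw]
  calc _ ≤ Real.exp ((ε / √(stepSize T l) * √(stepSize T L)) ^ 2 / 2) ^ 2 ^ (L - l) := by
        gcongr
        exact Real.cosh_le_exp_half_sq _
    _ = Real.exp (1 / 2) := by
        rw [← Real.exp_nat_mul, mul_pow, div_pow, Real.sq_sqrt h0.le, Real.sq_sqrt h1.le, hε,
          stepSize_eq_pow_mul h]
        congr 1
        push_cast
        field_simp

lemma integral_pow_weakIncrementLaw_le {T : ℝ} (hT : 0 < T) {L l : ℕ} (h : l ≤ L) (N : ℕ) :
    ∫ x, (|x| / √(stepSize T l)) ^ N ∂weakIncrementLaw T L l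
      ≤ N.factorial * (2 * Real.exp (1 / 2)) := by
  have hpos : 0 < √(stepSize T l) := Real.sqrt_pos.2 (stepSize_pos hT l)
  obtain ⟨F, hF, hFae⟩ := weakIncrementLaw_finite_support T L l
  have hint : ∀ g : ℝ → ℝ, Integrable g (weakIncrementLaw T L l) :=
    integrable_of_finite_support hF hFae
  -- From t^N / N! ≤ e^t at t = |x| / √Δ_l, with e^|u| ≤ e^u + e^(-u).
  have key : ∀ x : ℝ, (|x| / √(stepSize T l)) ^ N ≤ N.factorial *
      (Real.exp (1 / √(stepSize T l) * x) + Real.exp (-1 / √(stepSize T l) * x)) := by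
    intro x
    have h1 := Real.pow_div_factorial_le_exp (|x| / √(stepSize T l)) (by positivity) N
    rw [div_le_iff₀ (by positivity), mul_comm] at h1
    refine h1.trans ?_
    gcongr
    have e1 := Real.exp_pos (1 / √(stepSize T l) * x)
    have e2 := Real.exp_pos (-1 / √(stepSize T l) * x)
    rcases abs_cases x with ⟨hx, _⟩ | ⟨hx, _⟩ <;> rw [hx]
    · have : x / √(stepSize T l) = 1 / √(stepSize T l) * x := by ring
      rw [this]; linarith
    · have : -x / √(stepSize T l) = -1 / √(stepSize T l) * x := by ring
      rw [this]; linarith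
  refine (integral_mono (hint _) (hint _) key).trans ?_
  rw [integral_const_mul, integral_add (hint _) (hint _)]
  gcongr
  have a1 := integral_exp_normalized_le hT h (ε := 1) (by norm_num)
  have a2 := integral_exp_normalized_le hT h (ε := -1) (by norm_num)
  linarith

end Law

/-! ### From the law of an increment to the noise of a coarse step. -/

/-- The law of one vector increment with step `δ ^ 2`. -/
structure IsIncrementLaw {m : ℕ} (Ω : Matrix (Fin m) (Fin m) ℝ) (δ C : ℝ)
    (ν : Measure (Fin m → ℝ)) : Prop where
  prob : IsProbabilityMeasure ν
  finite_support : ∃ F : Set (Fin m → ℝ), F.Finite ∧ ∀ᵐ z ∂ν, z ∈ F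
  mean : ∀ j, ∫ z, z j ∂ν = 0
  cov : ∀ j k, ∫ z, quadIncr Ω δ z j k ∂ν = 0
  moment : ∀ j, ∫ z, (|z j| / δ) ^ 200 ∂ν ≤ C

/-- The scale attached to a pair of increments. -/
def pairScale {m : ℕ} (κ δ : ℝ) (p : (Fin m → ℝ) × (Fin m → ℝ)) : ℝ :=
  κ + (∑ j, |p.1 j| / δ + ∑ j, |p.2 j| / δ)

/-- The constant bounding the moment of `pairScale`. -/
def scaleMoment (m : ℕ) (κ C : ℝ) : ℝ :=
  2 ^ 199 * (κ ^ 200 + 2 ^ 199 * (m ^ 199 * (m * C) + m ^ 199 * (m * C)))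

lemma scaleMoment_nonneg (m : ℕ) (κ : ℝ) {C : ℝ} (hC : 0 ≤ C) :
    0 ≤ scaleMoment m κ C := by
  unfold scaleMoment; positivity

lemma pairScale_pow_le {m : ℕ} {κ δ : ℝ} (hκ : 0 ≤ κ) (hδ : 0 < δ)
    (p : (Fin m → ℝ) × (Fin m → ℝ)) :
    pairScale κ δ p ^ 200 ≤ 2 ^ 199 * (κ ^ 200 + 2 ^ 199 *
      (m ^ 199 * (∑ j, (|p.1 j| / δ) ^ 200) + m ^ 199 * (∑ j, (|p.2 j| / δ) ^ 200))) := by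
  have hs : ∀ z : Fin m → ℝ, (∑ j, |z j| / δ) ^ 200 ≤ m ^ 199 * ∑ j, (|z j| / δ) ^ 200 :=
    fun z => by
      simpa using pow_sum_le_card_mul_sum_pow (s := Finset.univ) (f := fun j => |z j| / δ)
        (fun j _ => by positivity) 199
  have h0 : ∀ z : Fin m → ℝ, 0 ≤ ∑ j, |z j| / δ := fun z => by positivity
  calc pairScale κ δ p ^ 200
      ≤ 2 ^ 199 * (κ ^ 200 + (∑ j, |p.1 j| / δ + ∑ j, |p.2 j| / δ) ^ 200) :=
        add_pow_le hκ (add_nonneg (h0 _) (h0 _)) 200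
    _ ≤ 2 ^ 199 * (κ ^ 200 + 2 ^ 199 * ((∑ j, |p.1 j| / δ) ^ 200 + (∑ j, |p.2 j| / δ) ^ 200)) := by
        gcongr
        exact add_pow_le (h0 _) (h0 _) 200
    _ ≤ _ := by
        gcongr
        · exact hs _
        · exact hs _

/-- Under the product measure each centring integral factorizes, and the factor of the centred
increment vanishes. -/
lemma IsIncrementLaw.isStepNoise {m : ℕ} {Ω : Matrix (Fin m) (Fin m) ℝ} {κ δ C : ℝ}
    {ν₁ ν₂ : Measure (Fin m → ℝ)} (h₁ : IsIncrementLaw Ω δ C ν₁) (h₂ : IsIncrementLaw Ω δ C ν₂)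
    (hκ : 4 ≤ κ) (hδ : 0 < δ) (hδκ : δ ≤ κ) (hΩ : ∑ j, ∑ k, |Ω j k| ≤ κ) :
    IsStepNoise (ν₁.prod ν₂) Ω κ δ (scaleMoment m κ C) Prod.fst Prod.snd (pairScale κ δ) := by
  have := h₁.prob
  have := h₂.prob
  obtain ⟨F₁, hF₁, ha₁⟩ := h₁.finite_support
  obtain ⟨F₂, hF₂, ha₂⟩ := h₂.finite_support
  have hint : ∀ g : (Fin m → ℝ) × (Fin m → ℝ) → ℝ, Integrable g (ν₁.prod ν₂) := by
    refine integrable_of_finite_support (hF₁.prod hF₂) ?_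
    filter_upwards [Measure.quasiMeasurePreserving_fst.ae ha₁,
      Measure.quasiMeasurePreserving_snd.ae ha₂] with p hp₁ hp₂ using ⟨hp₁, hp₂⟩
  refine ⟨hint, fun p => ?_, fun g j => ?_, fun g j => ?_, fun g j k => ?_, fun g j k => ?_, ?_⟩
  · have e0 : 0 ≤ ∑ j, |p.1 j| / δ := by positivity
    have e1 : 0 ≤ ∑ j, |p.2 j| / δ := by positivity
    have hle : κ ≤ pairScale κ δ p := by unfold pairScale; linarith
    have e2 : ∀ z : Fin m → ℝ, ∑ j, |z j| = δ * ∑ j, |z j| / δ := fun z => by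
      rw [← Finset.sum_div]; field_simp
    refine ⟨by linarith, hle, hδ, by linarith, by linarith, ?_, ?_⟩
    · rw [e2]; gcongr; unfold pairScale; linarith
    · rw [e2]; gcongr; unfold pairScale; linarith
  · rw [integral_prod_mul (fun z : Fin m → ℝ => z j) g, h₁.mean, zero_mul]
  · simp only [mul_comm _ (g _)]
    rw [integral_prod_mul g (fun z : Fin m → ℝ => z j), h₂.mean, mul_zero]
  · rw [integral_prod_mul (fun z : Fin m → ℝ => quadIncr Ω δ z j k) g, h₁.cov, zero_mul]
  · simp only [mul_comm _ (g _)]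
    rw [integral_prod_mul g (fun z : Fin m → ℝ => quadIncr Ω δ z j k), h₂.cov, mul_zero]
  · refine (integral_mono (hint _) (hint _) (pairScale_pow_le (by linarith) hδ)).trans ?_
    have m₁ : ∫ p : (Fin m → ℝ) × (Fin m → ℝ), ∑ j, (|p.1 j| / δ) ^ 200 ∂ν₁.prod ν₂ ≤ m * C := by
      rw [integral_finsetSum _ fun j _ => hint _]
      calc _ ≤ ∑ _j : Fin m, C := Finset.sum_le_sum fun j _ => by
            have := integral_prod_mul (μ := ν₁) (ν := ν₂) (fun z : Fin m → ℝ => (|z j| / δ) ^ 200)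
              (fun _ => (1 : ℝ))
            simp only [mul_one, integral_const, probReal_univ, smul_eq_mul] at this
            rw [this]
            exact h₁.moment j
        _ = _ := by simp
    have m₂ : ∫ p : (Fin m → ℝ) × (Fin m → ℝ), ∑ j, (|p.2 j| / δ) ^ 200 ∂ν₁.prod ν₂ ≤ m * C := by
      rw [integral_finsetSum _ fun j _ => hint _]
      calc _ ≤ ∑ _j : Fin m, C := Finset.sum_le_sum fun j _ => by
            have := integral_prod_mul (μ := ν₁) (ν := ν₂) (fun _ => (1 : ℝ))
              (fun z : Fin m → ℝ => (|z j| / δ) ^ 200)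
            simp only [one_mul, integral_const, probReal_univ, smul_eq_mul] at this
            rw [this]
            exact h₂.moment j
        _ = _ := by simp
    rw [integral_const_mul, integral_add (hint _) (hint _), integral_const_mul,
      integral_add (hint _) (hint _), integral_const_mul, integral_const_mul]
    simp only [integral_const, probReal_univ, one_smul]
    unfold scaleMoment
    gcongr

/-- A bound of the normalized moments of the weak increments. -/
def incrementMoment : ℝ := Nat.factorial 200 * (2 * Real.exp (1 / 2))

lemma incrementMoment_nonneg : 0 ≤ incrementMoment :=
  mul_nonneg (Nat.cast_nonneg _) (by positivity)

/-- Support, mean and moments come from the marginal laws of the components; the joint law of the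
components enters only through the covariance. -/
lemma isIncrementLaw_map {m : ℕ} {Ω : Matrix (Fin m) (Fin m) ℝ} {T : ℝ} (hT : 0 < T) {L l : ℕ}
    (hl : l ≤ L) {S : Type*} [MeasurableSpace S] {P : Measure S} [IsProbabilityMeasure P]
    {Z : S → Fin m → ℝ} (hlaw : ∀ j, HasLaw (fun s => Z s j) (weakIncrementLaw T L l) P)
    (hcorr : ∀ j k, ∫ s, Z s j * Z s k ∂P = Ω j k * stepSize T l) :
    IsIncrementLaw Ω √(stepSize T l) incrementMoment (P.map Z) := by
  have hZ : AEMeasurable Z P := aemeasurable_pi_iff.2 fun j => (hlaw j).aemeasurable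
  have hprob : IsProbabilityMeasure (P.map Z) := Measure.isProbabilityMeasure_map hZ
  obtain ⟨F, hF, hFae⟩ := weakIncrementLaw_finite_support T L l
  have hG : (Set.univ.pi fun _ : Fin m => F).Finite := Set.Finite.pi fun _ => hF
  have hGae : ∀ᵐ z ∂P.map Z, z ∈ Set.univ.pi fun _ : Fin m => F := by
    refine (ae_map_iff (p := fun z => z ∈ Set.univ.pi fun _ : Fin m => F) hZ
      hG.measurableSet).2 ?_
    have : ∀ j, ∀ᵐ s ∂P, Z s j ∈ F := fun j =>
      ((hlaw j).ae_iff (p := fun x => x ∈ F) (measurableSet_setOfPred.1 hF.measurableSet)).2 hFae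
    filter_upwards [ae_all_iff.2 this] with s hs j _ using hs j
  have hint : ∀ g : (Fin m → ℝ) → ℝ, Integrable g (P.map Z) := integrable_of_finite_support hG hGae
  have hcomp : ∀ (j : Fin m) {g : ℝ → ℝ}, Continuous g →
      ∫ z, g (z j) ∂P.map Z = ∫ x, g x ∂weakIncrementLaw T L l := fun j g hg => by
    have hc : Continuous fun z : Fin m → ℝ => g (z j) := by fun_prop
    rw [integral_map hZ hc.aestronglyMeasurable, ← (hlaw j).map_eq,
      integral_map (hlaw j).aemeasurable hg.aestronglyMeasurable]
  refine ⟨hprob, ⟨_, hG, hGae⟩, fun j => ?_, fun j k => ?_, fun j => ?_⟩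
  · rw [hcomp j (g := fun x => x) continuous_id, integral_id_weakIncrementLaw]
  · simp only [quadIncr]
    rw [integral_sub (hint _) (hint _), integral_map hZ (by fun_prop), hcorr,
      Real.sq_sqrt (stepSize_pos hT l).le]
    simp
  · rw [hcomp j (g := fun x => (|x| / √(stepSize T l)) ^ 200) (by fun_prop)]
    exact integral_pow_weakIncrementLaw_le hT hl 200

/-! ### The coupled paths: dependence on the increments and measurability. -/

section Coupling

variable {d m : ℕ} {μ : EuclideanSpace ℝ (Fin d) → EuclideanSpace ℝ (Fin d)}
  {σ : Fin m → EuclideanSpace ℝ (Fin d) → EuclideanSpace ℝ (Fin d)}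
  {Ω : Matrix (Fin m) (Fin m) ℝ}

/-- The fine, antithetic and coarse paths at the coarse times, driven by the fine increments. -/
def coupledPath (μ : EuclideanSpace ℝ (Fin d) → EuclideanSpace ℝ (Fin d))
    (σ : Fin m → EuclideanSpace ℝ (Fin d) → EuclideanSpace ℝ (Fin d))
    (Ω : Matrix (Fin m) (Fin m) ℝ) (x₀ : EuclideanSpace ℝ (Fin d)) (δ : ℝ) (z : ℕ → Fin m → ℝ) :
    ℕ → EuclideanSpace ℝ (Fin d) × EuclideanSpace ℝ (Fin d) × EuclideanSpace ℝ (Fin d)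
  | 0 => (x₀, x₀, x₀)
  | n + 1 => coupledStep μ σ Ω δ (coupledPath μ σ Ω x₀ δ z n) (z (2 * n)) (z (2 * n + 1))

lemma coupledPath_eq (x₀ : EuclideanSpace ℝ (Fin d)) (δ : ℝ) (z : ℕ → Fin m → ℝ) (n : ℕ) :
    coupledPath μ σ Ω x₀ δ z n = (milsteinPath μ σ Ω x₀ (δ ^ 2) z (2 * n),
      milsteinPath μ σ Ω x₀ (δ ^ 2) (antitheticIncrement z) (2 * n),
      milsteinPath μ σ Ω x₀ (2 * δ ^ 2) (coarseIncrement z) n) := by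
  induction n with
  | zero => rfl
  | succ n ih =>
    have h1 : antitheticIncrement z (2 * n) = z (2 * n + 1) := by simp [antitheticIncrement]
    have h2 : antitheticIncrement z (2 * n + 1) = z (2 * n) := by simp [antitheticIncrement]
    rw [coupledPath, ih, show 2 * (n + 1) = 2 * n + 1 + 1 by ring]
    simp only [milsteinPath, coupledStep, h1, h2, coarseIncrement]

/-- Increments with index beyond the time horizon carry no assumptions; this permits replacing them
by zero. -/
lemma coupledPath_congr (x₀ : EuclideanSpace ℝ (Fin d)) (δ : ℝ) {z z' : ℕ → Fin m → ℝ} (n : ℕ)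
    (h : ∀ i < 2 * n, z i = z' i) :
    coupledPath μ σ Ω x₀ δ z n = coupledPath μ σ Ω x₀ δ z' n := by
  induction n with
  | zero => rfl
  | succ n ih =>
    rw [coupledPath, coupledPath, ih fun i hi => h i (by omega), h _ (by omega), h _ (by omega)]

lemma continuous_milsteinStep (hμ : ContDiff ℝ 2 μ) (hσ : ∀ j, ContDiff ℝ 2 (σ j)) (h : ℝ) :
    Continuous fun p : EuclideanSpace ℝ (Fin d) × (Fin m → ℝ) =>
      milsteinStep μ σ Ω h p.1 p.2 := by
  have h1 := hμ.continuous
  have h2 := fun j => (hσ j).continuous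
  have h3 := fun j => (hσ j).continuous_fderiv (by norm_num)
  unfold milsteinStep
  fun_prop

lemma continuous_milsteinStep_comp (hμ : ContDiff ℝ 2 μ) (hσ : ∀ j, ContDiff ℝ 2 (σ j)) (h : ℝ)
    {X : Type*} [TopologicalSpace X] {a : X → EuclideanSpace ℝ (Fin d)} {b : X → Fin m → ℝ}
    (ha : Continuous a) (hb : Continuous b) :
    Continuous fun p => milsteinStep μ σ Ω h (a p) (b p) :=
  (continuous_milsteinStep hμ hσ h).comp (ha.prodMk hb)

lemma continuous_coupledStep (hμ : ContDiff ℝ 2 μ) (hσ : ∀ j, ContDiff ℝ 2 (σ j)) (δ : ℝ) :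
    Continuous fun p : (EuclideanSpace ℝ (Fin d) × EuclideanSpace ℝ (Fin d) ×
      EuclideanSpace ℝ (Fin d)) × ((Fin m → ℝ) × (Fin m → ℝ)) =>
      coupledStep μ σ Ω δ p.1 p.2.1 p.2.2 := by
  have hx : Continuous fun p : (EuclideanSpace ℝ (Fin d) × EuclideanSpace ℝ (Fin d) ×
      EuclideanSpace ℝ (Fin d)) × ((Fin m → ℝ) × (Fin m → ℝ)) => p.1.1 := by fun_prop
  have hx' : Continuous fun p : (EuclideanSpace ℝ (Fin d) × EuclideanSpace ℝ (Fin d) ×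
      EuclideanSpace ℝ (Fin d)) × ((Fin m → ℝ) × (Fin m → ℝ)) => p.1.2.1 := by fun_prop
  have hy : Continuous fun p : (EuclideanSpace ℝ (Fin d) × EuclideanSpace ℝ (Fin d) ×
      EuclideanSpace ℝ (Fin d)) × ((Fin m → ℝ) × (Fin m → ℝ)) => p.1.2.2 := by fun_prop
  have hz : Continuous fun p : (EuclideanSpace ℝ (Fin d) × EuclideanSpace ℝ (Fin d) ×
      EuclideanSpace ℝ (Fin d)) × ((Fin m → ℝ) × (Fin m → ℝ)) => p.2.1 := by fun_prop
  have hw : Continuous fun p : (EuclideanSpace ℝ (Fin d) × EuclideanSpace ℝ (Fin d) ×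
      EuclideanSpace ℝ (Fin d)) × ((Fin m → ℝ) × (Fin m → ℝ)) => p.2.2 := by fun_prop
  have h1 := continuous_milsteinStep_comp (Ω := Ω) hμ hσ (δ ^ 2)
    (continuous_milsteinStep_comp (Ω := Ω) hμ hσ (δ ^ 2) hx hz) hw
  have h2 := continuous_milsteinStep_comp (Ω := Ω) hμ hσ (δ ^ 2)
    (continuous_milsteinStep_comp (Ω := Ω) hμ hσ (δ ^ 2) hx' hw) hz
  have h3 := continuous_milsteinStep_comp (Ω := Ω) hμ hσ (2 * δ ^ 2) hy (hz.add hw)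
  unfold coupledStep
  exact h1.prodMk (h2.prodMk h3)

lemma continuous_lyapunov (δ : ℝ) : Continuous (lyapunov (d := d) δ) := by
  unfold lyapunov
  fun_prop

lemma measurable_coupledPath (hμ : ContDiff ℝ 2 μ) (hσ : ∀ j, ContDiff ℝ 2 (σ j))
    (x₀ : EuclideanSpace ℝ (Fin d)) (δ : ℝ) (n : ℕ) :
    Measurable fun z : ℕ → Fin m → ℝ => coupledPath μ σ Ω x₀ δ z n := by
  induction n with
  | zero => exact measurable_const
  | succ n ih =>
    have h1 : Measurable fun z : ℕ → Fin m → ℝ => (z (2 * n), z (2 * n + 1)) :=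
      (measurable_pi_apply (2 * n)).prodMk (measurable_pi_apply (2 * n + 1))
    have h2 := (continuous_coupledStep (Ω := Ω) hμ hσ δ).measurable
    have h3 := h2.comp (ih.prodMk h1)
    simp only [Function.comp_def] at h3
    simp only [coupledPath]
    exact h3

/-! ### Iteration along the coarse steps. -/

section Chain

variable {S : Type*} [MeasurableSpace S] {P : Measure S} [IsProbabilityMeasure P]

/-- The Markov step: independence allows the past `A` to be frozen while averaging over `B`. With
the Lebesgue integral in `ENNReal`, no integrability along the path has to be known beforehand. -/
lemma lintegral_comp_le_of_indepFun {X Y : Type*} [MeasurableSpace X] [MeasurableSpace Y]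
    {A : S → X} {B : S → Y} (hA : AEMeasurable A P) (hB : AEMeasurable B P) (hAB : IndepFun A B P)
    {F : X × Y → ENNReal} (hF : Measurable F) {G : X → ENNReal} (hG : Measurable G)
    (h : ∀ x, ∫⁻ y, F (x, y) ∂P.map B ≤ G x) :
    ∫⁻ s, F (A s, B s) ∂P ≤ ∫⁻ s, G (A s) ∂P := by
  have := Measure.isProbabilityMeasure_map hA
  have := Measure.isProbabilityMeasure_map hB
  calc ∫⁻ s, F (A s, B s) ∂P = ∫⁻ p, F p ∂P.map (fun s => (A s, B s)) :=
        (lintegral_map' hF.aemeasurable (hA.prodMk hB)).symm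
    _ = ∫⁻ x, ∫⁻ y, F (x, y) ∂P.map B ∂P.map A := by
        rw [hAB.map_prod_eq_prod_map_map hA hB, lintegral_prod _ hF.aemeasurable]
    _ ≤ ∫⁻ x, G x ∂P.map A := lintegral_mono h
    _ = _ := lintegral_map' hG.aemeasurable hA

variable {N : ℕ} {ζ : ℕ → S → Fin m → ℝ}

omit [IsProbabilityMeasure P] in
lemma aemeasurable_coupledPath (hμ : ContDiff ℝ 2 μ) (hσ : ∀ j, ContDiff ℝ 2 (σ j))
    (x₀ : EuclideanSpace ℝ (Fin d)) (δ : ℝ) {n : ℕ} (hn : 2 * n ≤ N)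
    (hζ : ∀ i < N, AEMeasurable (ζ i) P) :
    AEMeasurable (fun s => coupledPath μ σ Ω x₀ δ (fun i => ζ i s) n) P := by
  have h1 : AEMeasurable (fun s i => if i < N then ζ i s else 0) P := by
    refine aemeasurable_pi_iff.2 fun i => ?_
    by_cases hi : i < N
    · simpa [hi] using hζ i hi
    · simp [hi]
  refine ((measurable_coupledPath (Ω := Ω) hμ hσ x₀ δ n).comp_aemeasurable h1).congr
    (.of_forall fun s => ?_)
  exact coupledPath_congr x₀ δ n fun i hi => by simp [show i < N by omega]

-- The path up to coarse time `n` uses only increments with index below 2n, a block disjoint from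
-- the next two.
omit [IsProbabilityMeasure P] in
lemma indepFun_coupledPath (hμ : ContDiff ℝ 2 μ) (hσ : ∀ j, ContDiff ℝ 2 (σ j))
    (x₀ : EuclideanSpace ℝ (Fin d)) (δ : ℝ) {n : ℕ} (hn : 2 * n + 1 < N)
    (hζ : ∀ i < N, AEMeasurable (ζ i) P) (hind : iIndepFun (fun i : Fin N => ζ i) P) :
    IndepFun (fun s => coupledPath μ σ Ω x₀ δ (fun i => ζ i s) n)
      (fun s => (ζ (2 * n) s, ζ (2 * n + 1) s)) P := by
  let a : Fin N := ⟨2 * n, by omega⟩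
  let b : Fin N := ⟨2 * n + 1, hn⟩
  let A : Finset (Fin N) := Finset.univ.filter fun i => (i : ℕ) < 2 * n
  let B : Finset (Fin N) := {a, b}
  have hAB : Disjoint A B := by
    rw [Finset.disjoint_left]
    intro i hi hi'
    simp only [A, B, a, b, Finset.mem_filter, Finset.mem_univ, true_and, Finset.mem_insert,
      Finset.mem_singleton, Fin.ext_iff] at hi hi'
    omega
  have key := hind.indepFun_finset₀ A B hAB fun i => hζ i i.2
  have hmem : ∀ i, ∀ hi : i < 2 * n, (⟨i, by omega⟩ : Fin N) ∈ A := fun i hi => by simp [A, hi]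
  let φ : (A → Fin m → ℝ) → ℕ → Fin m → ℝ :=
    fun v i => if hi : i < 2 * n then v ⟨⟨i, by omega⟩, hmem i hi⟩ else 0
  have hφ : Measurable φ := by
    refine measurable_pi_iff.2 fun i => ?_
    by_cases hi : i < 2 * n
    · simp only [φ, hi, dif_pos]; exact measurable_pi_apply _
    · simp only [φ, hi, dif_neg, not_false_iff]; exact measurable_const
  have := key.comp ((measurable_coupledPath (Ω := Ω) hμ hσ x₀ δ n).comp hφ)
    (ψ := fun v : B → Fin m → ℝ => (v ⟨a, by simp [B]⟩, v ⟨b, by simp [B]⟩)) (by fun_prop)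
  refine this.congr (.of_forall fun s => ?_) (.of_forall fun s => rfl)
  exact coupledPath_congr x₀ δ n fun i hi => by simp [φ, hi]

lemma lintegral_lyapunov_le (hμ : ContDiff ℝ 2 μ) (hσ : ∀ j, ContDiff ℝ 2 (σ j))
    (x₀ : EuclideanSpace ℝ (Fin d)) {κ δ C : ℝ} (hμb : C2Bounds κ μ)
    (hσb : ∀ j, C2Bounds κ (σ j)) (hκ : 4 ≤ κ) (hδ : 0 < δ) (hδκ : δ ≤ κ)
    (hΩ : ∑ j, ∑ k, |Ω j k| ≤ κ)
    (hζ : ∀ i < N, AEMeasurable (ζ i) P) (hind : iIndepFun (fun i : Fin N => ζ i) P)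
    (hC : 0 ≤ C) (hlaw : ∀ i < N, IsIncrementLaw Ω δ C (P.map (ζ i))) {n : ℕ} (hn : 2 * n ≤ N) :
    ∫⁻ s, ENNReal.ofReal (lyapunov δ (coupledPath μ σ Ω x₀ δ (fun i => ζ i s) n)) ∂P
      ≤ ENNReal.ofReal ((1 + 20000 * scaleMoment m κ C * δ ^ 2) ^ n *
        lyapunov δ (x₀, x₀, x₀)) := by
  have hK : 0 ≤ 1 + 20000 * scaleMoment m κ C * δ ^ 2 := by
    have := scaleMoment_nonneg m κ hC
    positivity
  induction n with
  | zero => simp [coupledPath]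
  | succ n ih =>
    have hP1 := (hlaw (2 * n) (by omega)).prob
    have hP2 := (hlaw (2 * n + 1) (by omega)).prob
    have hmeas : Measurable fun x : EuclideanSpace ℝ (Fin d) × EuclideanSpace ℝ (Fin d) ×
      EuclideanSpace ℝ (Fin d) => ENNReal.ofReal (lyapunov δ x) :=
      (continuous_lyapunov δ).measurable.ennreal_ofReal
    have hab : IndepFun (ζ (2 * n)) (ζ (2 * n + 1)) P :=
      hind.indepFun (i := ⟨2 * n, by omega⟩) (j := ⟨2 * n + 1, by omega⟩) (by simp)
    have hnoise := (hlaw (2 * n) (by omega)).isStepNoise (hlaw (2 * n + 1) (by omega)) hκ hδ hδκ hΩ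
    have step := lintegral_comp_le_of_indepFun
      (F := fun p => ENNReal.ofReal (lyapunov δ (coupledStep μ σ Ω δ p.1 p.2.1 p.2.2)))
      (G := fun x => ENNReal.ofReal (1 + 20000 * scaleMoment m κ C * δ ^ 2) *
        ENNReal.ofReal (lyapunov δ x))
      (aemeasurable_coupledPath hμ hσ x₀ δ (n := n) (by omega) hζ)
      ((hζ _ (by omega)).prodMk (hζ _ (by omega)))
      (indepFun_coupledPath (Ω := Ω) hμ hσ x₀ δ (by omega) hζ hind)
      (hmeas.comp (continuous_coupledStep hμ hσ δ).measurable) (hmeas.const_mul _) (fun x => by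
        rw [hab.map_prod_eq_prod_map_map (hζ _ (by omega)) (hζ _ (by omega)),
          ← ofReal_integral_eq_lintegral_ofReal (hnoise.integrable _)
          (.of_forall fun _ => lyapunov_nonneg _ _), ← ENNReal.ofReal_mul hK]
        exact ENNReal.ofReal_le_ofReal (hnoise.integral_lyapunov_le hμb hσb x))
    refine step.trans ?_
    rw [lintegral_const_mul' _ _ ENNReal.ofReal_ne_top]
    refine (mul_le_mul_right (ih (by omega)) _).trans ?_
    rw [← ENNReal.ofReal_mul hK]
    exact ENNReal.ofReal_le_ofReal (le_of_eq (by ring))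

/-- Integrability and variance from a bound of the second moment. -/
lemma memLp_two_and_variance_le {Y : S → ℝ} (hY : AEMeasurable Y P) {c : ℝ} (hc : 0 ≤ c)
    (h : ∫⁻ s, ENNReal.ofReal (Y s ^ 2) ∂P ≤ ENNReal.ofReal c) :
    MemLp Y 2 P ∧ variance Y P ≤ c := by
  refine ⟨?_, ?_⟩
  · rw [memLp_two_iff_integrable_sq hY.aestronglyMeasurable]
    refine (lintegral_ofReal_ne_top_iff_integrable (hY.pow_const 2).aestronglyMeasurable
      (.of_forall fun s => sq_nonneg _)).1 (h.trans_lt ENNReal.ofReal_lt_top).ne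
  · refine (variance_le_expectation_sq hY.aestronglyMeasurable).trans ?_
    simp only [Pi.pow_apply]
    rw [integral_eq_lintegral_of_nonneg_ae (.of_forall fun s => sq_nonneg _)
      (hY.pow_const 2).aestronglyMeasurable]
    exact ENNReal.toReal_le_of_le_ofReal hc h

end Chain

/-! ### The payoff difference. -/

/-- The antithetic payoff difference as a function of the final states of the three paths. -/
def payoffDiff (f : EuclideanSpace ℝ (Fin d) → ℝ)
    (s : EuclideanSpace ℝ (Fin d) × EuclideanSpace ℝ (Fin d) × EuclideanSpace ℝ (Fin d)) : ℝ :=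
  (1 / 2) * (f s.1 + f s.2.1) - f s.2.2

/-- Linearizing f at the coarse state turns the first-order terms into f'(y)e, leaving only squares
of x − y and x' − y. Squaring once more matches the first two pieces of the Lyapunov function; the
δ⁴ piece is discarded. -/
lemma payoffDiff_sq_le {f : EuclideanSpace ℝ (Fin d) → ℝ} {κ : ℝ} (hf : C2Bounds κ f) (δ : ℝ)
    (s : EuclideanSpace ℝ (Fin d) × EuclideanSpace ℝ (Fin d) × EuclideanSpace ℝ (Fin d)) :
    payoffDiff f s ^ 2 ≤ 2 * κ ^ 2 * lyapunov δ s := by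
  obtain ⟨x, x', y⟩ := s
  have e : payoffDiff f (x, x', y) = (1 / 2) * (f x - f y - fderiv ℝ f y (x - y))
      + (1 / 2) * (f x' - f y - fderiv ℝ f y (x' - y))
      + fderiv ℝ f y ((1 / 2 : ℝ) • (x + x') - y) := by
    simp only [payoffDiff, map_sub, map_smul, map_add, smul_eq_mul]
    ring
  have h1 := hf.taylor y x
  have h2 := hf.taylor y x'
  have h3 : ‖fderiv ℝ f y ((1 / 2 : ℝ) • (x + x') - y)‖ ≤ κ * ‖(1 / 2 : ℝ) • (x + x') - y‖ :=
    (ContinuousLinearMap.le_opNorm _ _).trans (by gcongr; exact hf.fderiv_le y)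
  have h4 : |payoffDiff f (x, x', y)| ≤ κ * (‖(1 / 2 : ℝ) • (x + x') - y‖
      + (1 / 2) * (‖x - y‖ ^ 2 + ‖x' - y‖ ^ 2)) := by
    rw [Real.norm_eq_abs] at h1 h2 h3
    rw [e, abs_le]
    rw [abs_le] at h1 h2 h3
    constructor <;> linarith [h1.1, h1.2, h2.1, h2.2, h3.1, h3.2]
  have h5 : ((‖(1 / 2 : ℝ) • (x + x') - y‖ + (1 / 2) * (‖x - y‖ ^ 2 + ‖x' - y‖ ^ 2))) ^ 2
      ≤ 2 * lyapunov δ (x, x', y) := by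
    have : 0 ≤ δ ^ 4 * (3 + ‖x‖ ^ 4 + ‖x'‖ ^ 4 + ‖y‖ ^ 4) := by positivity
    have i1 : (‖(1 / 2 : ℝ) • (x + x') - y‖ + (1 / 2) * (‖x - y‖ ^ 2 + ‖x' - y‖ ^ 2)) ^ 2
      ≤ 2 * (‖(1 / 2 : ℝ) • (x + x') - y‖ ^ 2
        + ((1 / 2) * (‖x - y‖ ^ 2 + ‖x' - y‖ ^ 2)) ^ 2) := add_sq_le
    have i2 : (‖x - y‖ ^ 2 + ‖x' - y‖ ^ 2) ^ 2 ≤ 2 * ((‖x - y‖ ^ 2) ^ 2 + (‖x' - y‖ ^ 2) ^ 2) :=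
      add_sq_le
    have i3 : ((1 / 2) * (‖x - y‖ ^ 2 + ‖x' - y‖ ^ 2)) ^ 2 =
      (1 / 4) * (‖x - y‖ ^ 2 + ‖x' - y‖ ^ 2) ^ 2 := by ring
    have i4 : ∀ t : ℝ, (t ^ 2) ^ 2 = t ^ 4 := fun t => by ring
    have p1 : 0 ≤ ‖x - y‖ ^ 4 := by positivity
    have p2 : 0 ≤ ‖x' - y‖ ^ 4 := by positivity
    rw [i3] at i1
    rw [i4, i4] at i2
    simp only [lyapunov]
    linarith
  calc payoffDiff f (x, x', y) ^ 2 = |payoffDiff f (x, x', y)| ^ 2 := (sq_abs _).symm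
    _ ≤ (κ * (‖(1 / 2 : ℝ) • (x + x') - y‖ + (1 / 2) * (‖x - y‖ ^ 2 + ‖x' - y‖ ^ 2))) ^ 2 := by
        gcongr
    _ = κ ^ 2 * (‖(1 / 2 : ℝ) • (x + x') - y‖ + (1 / 2) * (‖x - y‖ ^ 2 + ‖x' - y‖ ^ 2)) ^ 2 := by
        ring
    _ ≤ κ ^ 2 * (2 * lyapunov δ (x, x', y)) := by gcongr
    _ = _ := by ring

lemma finePayoff_sub_coarsePayoff (x₀ : EuclideanSpace ℝ (Fin d))
    (f : EuclideanSpace ℝ (Fin d) → ℝ) {T : ℝ} (hT : 0 < T) (n : ℕ) (z : ℕ → Fin m → ℝ) :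
    finePayoff μ σ Ω x₀ f T (n + 1) z - coarsePayoff μ σ Ω x₀ f T n (coarseIncrement z)
      = payoffDiff f (coupledPath μ σ Ω x₀ √(stepSize T (n + 1)) z (2 ^ n)) := by
  rw [coupledPath_eq, Real.sq_sqrt (stepSize_pos hT _).le, finePayoff, coarsePayoff, payoffDiff,
    ← pow_succ']
  have : 2 * stepSize T (n + 1) = stepSize T n := by
    unfold stepSize; rw [pow_succ]; field_simp
  rw [this]

end Coupling

end WeakMilstein

end

/-! ### Assembly of the variance bound. -/

theorem theorem1 {d m : ℕ}
    (μ : EuclideanSpace ℝ (Fin d) → EuclideanSpace ℝ (Fin d))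
    (σ : Fin m → EuclideanSpace ℝ (Fin d) → EuclideanSpace ℝ (Fin d))
    (Ω : Matrix (Fin m) (Fin m) ℝ) (x₀ : EuclideanSpace ℝ (Fin d))
    (T : ℝ) (hT : 0 < T) (f : EuclideanSpace ℝ (Fin d) → ℝ)
    (hμ : WeakMilstein.IsLipschitzC2 μ) (hσ : ∀ j, WeakMilstein.IsLipschitzC2 (σ j))
    (hf : WeakMilstein.IsLipschitzC2 f) :
    ∃ C : ℝ, ∀ L l M : ℕ, 1 ≤ l → l ≤ L → 1 ≤ M →
      ∀ (S : Type*) [MeasurableSpace S] (P : Measure S) [IsProbabilityMeasure P]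
        (ξ : Fin M → ℕ → S → Fin m → ℝ), WeakMilstein.IsWeakIncrements P T Ω L l M ξ →
        MemLp (fun s => WeakMilstein.levelEstimator μ σ Ω x₀ f T l M (fun r i => ξ r i s)) 2 P ∧
        variance (fun s => WeakMilstein.levelEstimator μ σ Ω x₀ f T l M (fun r i => ξ r i s)) P
          ≤ C * WeakMilstein.stepSize T l ^ 2 / M := by
  open WeakMilstein in
  obtain ⟨κ₁, hκ₁, hμb⟩ := hμ.exists_bounds
  choose κ₂ hκ₂ hσb using fun j => (hσ j).exists_bounds
  obtain ⟨κ₃, hκ₃, hfb⟩ := hf.exists_bounds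
  have hs₂ : 0 ≤ ∑ j, κ₂ j := Finset.sum_nonneg fun j _ => hκ₂ j
  have hsΩ : 0 ≤ ∑ j, ∑ k, |Ω j k| := by positivity
  have hsT := Real.sqrt_nonneg T
  -- One constant for all requirements on the scale: at least 4, above the constants of μ and each
  -- σ_j, above √T ≥ √Δ_l, and above the entry sum of |Ω|. The payoff keeps its own `κ₃`.
  obtain ⟨κ, hκ⟩ : ∃ κ, κ = 4 + κ₁ + ∑ j, κ₂ j + √T + ∑ j, ∑ k, |Ω j k| := ⟨_, rfl⟩
  have hμb' : C2Bounds κ μ := hμb.mono (by linarith)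
  have hσb' : ∀ j, C2Bounds κ (σ j) := fun j => (hσb j).mono (by
    have := Finset.single_le_sum (f := κ₂) (fun i _ => hκ₂ i) (Finset.mem_univ j)
    linarith)
  have hμc := hμ.1
  have hσc := fun j => (hσ j).1
  obtain ⟨K, hK⟩ : ∃ K, K = 20000 * scaleMoment m κ incrementMoment := ⟨_, rfl⟩
  have hK0 : 0 ≤ K := by
    rw [hK]
    exact mul_nonneg (by norm_num) (scaleMoment_nonneg m κ incrementMoment_nonneg)
  -- The payoff comparison gives 2κ₃², the growth over all coarse steps exp(KT), and the initial
  -- Lyapunov value is Δ_l² times the last factor, as the three paths start together.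
  refine ⟨2 * κ₃ ^ 2 * (Real.exp (K * T) * (3 + ‖x₀‖ ^ 4 + ‖x₀‖ ^ 4 + ‖x₀‖ ^ 4)), ?_⟩
  intro L l M hl hlL hM S _ P _ ξ hξ
  obtain ⟨n, rfl⟩ : ∃ n, l = n + 1 := ⟨l - 1, by omega⟩
  set h := stepSize T (n + 1) with hh
  have hh0 : 0 < h := stepSize_pos hT _
  have hδ : 0 < √h := Real.sqrt_pos.2 hh0
  have hae : ∀ r, ∀ i < 2 ^ (n + 1), AEMeasurable (ξ r i) P := fun r i hi =>
    aemeasurable_pi_iff.2 fun j => (hξ.law r i hi j).aemeasurable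
  have hlaw : ∀ r, ∀ i < 2 ^ (n + 1), IsIncrementLaw Ω √h incrementMoment (P.map (ξ r i)) :=
    fun r i hi => isIncrementLaw_map hT hlL (hξ.law r i hi) (hξ.corr r i hi)
  have hn2 : 2 * 2 ^ n ≤ 2 ^ (n + 1) := (pow_succ' 2 n).ge
  have hfc : Continuous (payoffDiff f) := by
    have := hf.1.continuous
    unfold payoffDiff; fun_prop
  let Y : Fin M → S → ℝ := fun r s =>
    payoffDiff f (coupledPath μ σ Ω x₀ √h (fun i => ξ r i s) (2 ^ n))
  have hY : ∀ r, MemLp (Y r) 2 P ∧ variance (Y r) P ≤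
      2 * κ₃ ^ 2 * (Real.exp (K * T) * (3 + ‖x₀‖ ^ 4 + ‖x₀‖ ^ 4 + ‖x₀‖ ^ 4)) * h ^ 2 := by
    intro r
    refine memLp_two_and_variance_le (hfc.measurable.comp_aemeasurable
      (aemeasurable_coupledPath hμc hσc x₀ √h hn2 (hae r))) (by positivity) ?_
    have hind : iIndepFun (fun i : Fin (2 ^ (n + 1)) => ξ r i) P :=
      hξ.indep.precomp (g := fun i => (r, i)) (Prod.mk_right_injective r)
    have key := lintegral_lyapunov_le hμc hσc x₀ hμb' hσb' (by linarith) hδ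
      ((Real.sqrt_le_sqrt (stepSize_le hT _)).trans (by linarith)) (by linarith) (hae r) hind
      incrementMoment_nonneg (hlaw r) hn2
    rw [← hK, Real.sq_sqrt hh0.le] at key
    calc ∫⁻ s, ENNReal.ofReal (Y r s ^ 2) ∂P
        ≤ ∫⁻ s, ENNReal.ofReal (2 * κ₃ ^ 2) * ENNReal.ofReal (lyapunov √h
            (coupledPath μ σ Ω x₀ √h (fun i => ξ r i s) (2 ^ n))) ∂P := by
          refine lintegral_mono fun s => ?_
          rw [← ENNReal.ofReal_mul (by positivity)]
          exact ENNReal.ofReal_le_ofReal (payoffDiff_sq_le hfb _ _)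
      _ ≤ ENNReal.ofReal (2 * κ₃ ^ 2) * ENNReal.ofReal ((1 + K * h) ^ 2 ^ n *
            lyapunov √h (x₀, x₀, x₀)) := by
          rw [lintegral_const_mul' _ _ ENNReal.ofReal_ne_top]
          exact mul_le_mul_right key _
      _ ≤ _ := by
          rw [← ENNReal.ofReal_mul (by positivity)]
          refine ENNReal.ofReal_le_ofReal ?_
          -- There are 2^n coarse steps and 2^n h = T/2, so exp(KT/2) would suffice.
          have h1 : (1 + K * h) ^ 2 ^ n ≤ Real.exp (K * T) := by
            calc (1 + K * h) ^ 2 ^ n ≤ Real.exp (K * h) ^ 2 ^ n := by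
                  gcongr
                  rw [add_comm]; exact Real.add_one_le_exp _
              _ = Real.exp (K * (2 ^ n * h)) := by
                  rw [← Real.exp_nat_mul]; push_cast; congr 1; ring
              _ ≤ _ := by
                  gcongr
                  rw [hh, stepSize, pow_succ]
                  have : (2 : ℝ) ^ n * (T / (2 ^ n * 2)) = T / 2 := by field_simp
                  linarith
          have h2 : lyapunov √h (x₀, x₀, x₀) = h ^ 2 * (3 + ‖x₀‖ ^ 4 + ‖x₀‖ ^ 4 + ‖x₀‖ ^ 4) := by
            have e1 : (1 / 2 : ℝ) • (x₀ + x₀) - x₀ = 0 := by module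
            have e2 : √h ^ 4 = h ^ 2 := by
              rw [show √h ^ 4 = (√h ^ 2) ^ 2 by ring, Real.sq_sqrt hh0.le]
            simp only [lyapunov, e1, e2, sub_self, norm_zero]
            ring
          rw [h2]
          calc _ ≤ 2 * κ₃ ^ 2 * (Real.exp (K * T) *
                (h ^ 2 * (3 + ‖x₀‖ ^ 4 + ‖x₀‖ ^ 4 + ‖x₀‖ ^ 4))) := by gcongr
            _ = _ := by ring
  -- Different realizations use disjoint blocks of the independent family; pairwise independence is
  -- enough for the variance of the sum.
  have hindY : Pairwise fun r r' => IndepFun (Y r) (Y r') P := by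
    intro r r' hrr
    let A : Fin M → Finset (Fin M × Fin (2 ^ (n + 1))) := fun r => Finset.univ.filter (·.1 = r)
    have hA : Disjoint (A r) (A r') := by
      rw [Finset.disjoint_left]
      intro p hp hp'
      simp only [A, Finset.mem_filter, Finset.mem_univ, true_and] at hp hp'
      exact hrr (hp.symm.trans hp')
    have key := hξ.indep.indepFun_finset₀ (A r) (A r') hA fun p => hae p.1 p.2 p.2.2
    let φ : ∀ r, (A r → Fin m → ℝ) → ℕ → Fin m → ℝ := fun r v i =>
      if hi : i < 2 ^ (n + 1) then v ⟨(r, ⟨i, hi⟩), by simp [A]⟩ else 0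
    have hφ : ∀ r, Measurable (φ r) := fun r => by
      refine measurable_pi_iff.2 fun i => ?_
      by_cases hi : i < 2 ^ (n + 1)
      · simp only [φ, hi, dif_pos]; exact measurable_pi_apply _
      · simp only [φ, hi, dif_neg, not_false_iff]; exact measurable_const
    have hg : ∀ r, Measurable fun v =>
        payoffDiff f (coupledPath μ σ Ω x₀ √h (φ r v) (2 ^ n)) := fun r =>
      hfc.measurable.comp ((measurable_coupledPath hμc hσc x₀ √h (2 ^ n)).comp (hφ r))
    have heq : ∀ r, Y r = (fun v => payoffDiff f (coupledPath μ σ Ω x₀ √h (φ r v) (2 ^ n))) ∘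
        fun s (p : A r) => ξ p.1.1 p.1.2 s := fun r => by
      funext s
      refine congrArg (payoffDiff f) (coupledPath_congr x₀ _ _ fun i hi => ?_)
      simp [φ, hi.trans_le hn2]
    rw [heq r, heq r']
    exact key.comp (hg r) (hg r')
  have hest : (fun s => levelEstimator μ σ Ω x₀ f T (n + 1) M (fun r i => ξ r i s)) =
      fun s => (M : ℝ)⁻¹ * (∑ r, Y r) s := by
    funext s
    simp only [levelEstimator, Nat.add_sub_cancel, finePayoff_sub_coarsePayoff x₀ f hT,
      Finset.sum_apply, Y, hh]
  rw [hest]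
  refine ⟨(memLp_finsetSum' _ fun r _ => (hY r).1).const_mul _, ?_⟩
  have hM' : (0 : ℝ) < M := by exact_mod_cast hM
  rw [variance_const_mul, IndepFun.variance_sum (fun r _ => (hY r).1)
    (fun r _ r' _ hrr => hindY hrr)]
  -- M equal bounds against the factor M⁻² leave 1/M.
  calc _ ≤ (M : ℝ)⁻¹ ^ 2 * ∑ _r : Fin M, (2 * κ₃ ^ 2 * (Real.exp (K * T) *
          (3 + ‖x₀‖ ^ 4 + ‖x₀‖ ^ 4 + ‖x₀‖ ^ 4)) * h ^ 2) := by
        gcongr with r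
        exact (hY r).2
    _ = _ := by
        rw [Finset.sum_const, Finset.card_univ, Fintype.card_fin, nsmul_eq_mul]
        field_simp
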